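/- Let $G=(V,E)$ be a finite connected simple graph with $n=|V|\ge 2$ nodes and (hop) diameter $D$, whose edges carry weights $w(e)\in\{0,1,2,\dots\}$, and let $T$ be a spanning tree of $G$ rooted at $r$. For $X\subseteq V$ put $\mathrm{cut}(X)=\sum_{(x,y)\in E,\ x\in X,\ y\notin X} w(x,y)$; for $v\in V$ let $v^{\downarrow}$ be the set of descendants of $v$ in $T$, including $v$. Let $$c^*=\min_{v\in V\setminus\{r\}}\mathrm{cut}(v^{\downarrow}),$$ the smallest value of a cut obtained by removing one edge of $T$ (a cut that 1-respects $T$). In the CONGEST model the nodes of $G$ compute in synchronous rounds; in each round every node may send one message of $O(\log n)$ bits to each of its neighbours, and local computation is free. The nodes have distinct identifiers; identifiers and edge weights are natural numbers at most $n^{c}$ for a constant $c$. Initially a node knows only its identifier, the weights of its incident edges, and which incident edge leads to its parent in $T$ (none for $r$); in particular $n$ and $D$ are not known. **Theorem.** There are a deterministic distributed algorithm and a constant $k$ such that for every constant $c$, on all such inputs, the algorithm uses messages of $O(\log n)$ bits, and after $O\big((\sqrt n+D)\log^{k} n\big)=\tilde O(\sqrt n+D)$ rounds all nodes have halted (the implied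 constants depend only on $c$). At that time every node knows $c^*$ and the identifier of one and the same node $v^*\neq r$ with $\mathrm{cut}((v^*)^{\downarrow})=c^*$, and every node $v$ knows $\mathrm{cut}(v^{\downarrow})$. -/

import Mathlib

noncomputable section

/-! ### Weighted networks, rooted spanning trees and cuts -/

/-- A finite, connected, simple, undirected network with natural-number edge weights (only the
values `weight e` at edges `e` of `graph` matter), pairwise distinct node identifiers, and an
arbitrary port numbering: node `v` sees its incident links as ports `0, …, deg v - 1`. -/
structure Network (V : Type) [Fintype V] where
  graph : SimpleGraph V
  connected : graph.Connected
  weight : Sym2 V → ℕ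
  uid : V → ℕ
  uid_injective : Function.Injective uid
  deg : V → ℕ
  port : ∀ v : V, Fin (deg v) ≃ graph.neighborSet v

/-- A spanning tree of `G` together with a distinguished root. -/
structure RootedSpanningTree {V : Type} (G : SimpleGraph V) where
  tree : SimpleGraph V
  le : tree ≤ G
  isTree : tree.IsTree
  root : V

namespace RootedSpanningTree

variable {V : Type} {G : SimpleGraph V}

/-- `v↓`: the descendants of `v`, including `v`, i.e. the nodes `u` such that `v` lies on the path
of the tree from the root to `u`. -/
def desc (T : RootedSpanningTree G) (v : V) : Set V :=
  {u | ∃ p : T.tree.Walk T.root u, p.IsPath ∧ v ∈ p.support}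

/-- `u` is the parent of `v`. -/
def IsParent (T : RootedSpanningTree G) (u v : V) : Prop :=
  T.tree.Adj u v ∧ v ∈ T.desc u

end RootedSpanningTree

namespace Network

variable {V : Type} [Fintype V]

open Classical in
/-- `cut(X)`, the total weight of the edges with exactly one endpoint in `X`: the sum runs over the
pairs `(x, y)` with `x ∈ X` and `y ∉ X`, so each such edge is counted once. -/
def cut (N : Network V) (X : Set V) : ℕ :=
  ∑ x : V, ∑ y : V, if N.graph.Adj x y ∧ x ∈ X ∧ y ∉ X then N.weight s(x, y) else 0

/-- The neighbour of `v` at port `i`. -/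
def nbr (N : Network V) (v : V) (i : Fin (N.deg v)) : V := (N.port v i : V)

theorem adj_nbr (N : Network V) (v : V) (i : Fin (N.deg v)) : N.graph.Adj v (N.nbr v i) :=
  (N.port v i).2

/-- The port number that the neighbour of `v` at port `i` itself uses for the link to `v`. -/
def backPort (N : Network V) (v : V) (i : Fin (N.deg v)) : Fin (N.deg (N.nbr v i)) :=
  (N.port (N.nbr v i)).symm ⟨v, (N.adj_nbr v i).symm⟩

end Network

/-! ### The CONGEST model -/

/-- What a node knows initially about one of its links: the weight of the edge, and whether the
edge leads to the parent of the node in the given rooted tree. -/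
structure LinkInfo where
  weight : ℕ
  toParent : Bool

/-- What a node knows initially: its own identifier, and its links in the order of the ports. -/
structure LocalInput where
  uid : ℕ
  links : List LinkInfo

/-- A deterministic synchronous message-passing algorithm with outputs in `Out`, the same for all
nodes of all networks. In each round a node sends the bit string `send s i` through its port `i`
(the empty string means that nothing is sent), then receives the list of the messages that
arrived, in the order of its ports, and changes its state. A node halts as soon as `output` of its
state is defined. Local computation is free. -/
structure CongestAlgorithm (Out : Type) where
  State : Type
  start : LocalInput → State
  send : State → ℕ → List Bool
  step : State → List (List Bool) → State
  output : State → Option Out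

namespace CongestAlgorithm

variable {Out V : Type} [Fintype V]

open Classical in
/-- The initial knowledge of node `v`. -/
def localInput (N : Network V) (T : RootedSpanningTree N.graph) (v : V) : LocalInput where
  uid := N.uid v
  links := List.ofFn fun i : Fin (N.deg v) =>
    { weight := N.weight s(v, N.nbr v i)
      toParent := decide (T.IsParent (N.nbr v i) v) }

/-- The message that a node in state `s` puts on its port `i`; a halted node is silent. -/
def message (A : CongestAlgorithm Out) (s : A.State) (i : ℕ) : List Bool :=
  if (A.output s).isSome then [] else A.send s i

/-- The list of the messages that node `v` receives when the nodes are in the states `σ`. -/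
def inbox (A : CongestAlgorithm Out) (N : Network V) (σ : V → A.State) (v : V) :
    List (List Bool) :=
  List.ofFn fun i : Fin (N.deg v) => A.message (σ (N.nbr v i)) (N.backPort v i)

/-- The states of the nodes after `t` rounds; a halted node keeps its state for ever. -/
def config (A : CongestAlgorithm Out) (N : Network V) (T : RootedSpanningTree N.graph) :
    ℕ → V → A.State
  | 0, v => A.start (localInput N T v)
  | t + 1, v =>
    if (A.output (A.config N T t v)).isSome then A.config N T t v
    else A.step (A.config N T t v) (A.inbox N (A.config N T t) v)

end CongestAlgorithm

/-- The output of a node `v`: the value `cut(v↓)`, the value `c*`, and the identifier of a node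
that attains `c*`. -/
structure OneRespectOutput where
  ownCut : ℕ
  minCut : ℕ
  minNode : ℕ

end

noncomputable section

open scoped Classical

/-! ### Node programs with one-bit messages -/

/-! Neither `n` nor `D` is known, so the algorithm runs phases `j = 0, 1, 2, …` with the guess `L =
2^j` for `√n + D` and the guess `b = j²` for the bit length of the inputs. Every phase ends at all
nodes in the same round, and all nodes agree on whether it succeeded; the first success is output.
Numbers of `m = 6b + 8` bits are sent bit by bit. Phase `j` takes `O(L b m) = O(j⁴ 2^j)` rounds for
`j ≥ 1`, so the last phase dominates the sum up to a constant. A phase with `L ≥ D`, `L² ≥ n` and `j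
> 2c` succeeds (`fits_of_le`, `Fits.small`), hence the last one has `2^j = O(√n + D)`.

A phase builds a skeleton of `T`. Bitwise elimination on identifiers leaves nodes with pairwise tree
distance above `2L`, while every node has one of them within `A = 2Lb` (`cand_independent`,
`exists_cand_near`). If `n ≤ L²`, at most `L + 1` remain, and with the root and the branching points
there are at most `2L + 3` (`card_closure_le`). Every node has a skeleton ancestor within `O(A)`
steps (`exists_closure_iterate`). A node has at most one highest skeleton node below it, again at
distance `O(A)` (`Top.unique`, `Top.depth_le_closure`). The skeleton is small enough to be announced
to everybody by gossip, so long paths of `T` need never be walked. Whether `v` is an ancestor of `y`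
becomes a test on nearby data and the skeleton (`IsSkeleton.anc_iff`), so a node can tell which of
its links leave the subtrees in question.

For a skeleton node `s`, `cut(s↓)` is a sum of local shares over all nodes. These sums are pipelined
to the root of a breadth-first search tree (`upcast_skelShare`) and broadcast. For another node `v`,
let `B` be the part of `v↓` below the highest skeleton node under `v`, or empty if there is none.
Then `cut(v↓) = cut(B) + w(v↓ ∖ B, V ∖ v↓) - w(v↓ ∖ B, B)` (`cutWeight_add`). Here `cut(B)` is
already known, and `v↓ ∖ B` reaches only `O(A)` below `v`, so the other two terms are pipelined up
`T` itself (`upcast_outShare`, `upcast_hangShare`). Flooding finally finds the minimum together with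
an identifier. -/

/-- A program of a node that sends one bit to all its neighbours in each round and receives one
bit through every port. -/
inductive NodeProgram (α : Type) : Type
  | done (a : α) : NodeProgram α
  | round (b : Bool) (k : (ℕ → Bool) → NodeProgram α) : NodeProgram α

namespace NodeProgram

/-- Sequential composition. -/
def bind {α β : Type} : NodeProgram α → (α → NodeProgram β) → NodeProgram β
  | done a, q => q a
  | round b k, q => round b fun x => bind (k x) q

end NodeProgram

/-! ### Networks and synchronous execution. -/

/-- A network together with a rooted spanning tree. -/
structure RootedNetwork where
  V : Type
  [fintype : Fintype V]
  [nontrivial : Nontrivial V]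
  N : Network V
  T : RootedSpanningTree N.graph

namespace RootedNetwork

attribute [instance] RootedNetwork.fintype RootedNetwork.nontrivial

variable (I : RootedNetwork)

/-- The neighbour of `v` at port `i`, and `v` itself if there is no such port. -/
def nb (v : I.V) (i : ℕ) : I.V := if h : i < I.N.deg v then I.N.nbr v ⟨i, h⟩ else v

/-- What `v` receives when every node `u` sends `m u`. -/
def received {β : Type} [Inhabited β] (m : I.V → β) (v : I.V) (i : ℕ) : β :=
  if i < I.N.deg v then m (I.nb v i) else default

/-- The initial knowledge. -/
def input (v : I.V) : LocalInput := CongestAlgorithm.localInput I.N I.T v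

theorem adj_nb {v : I.V} {i : ℕ} (h : i < I.N.deg v) : I.N.graph.Adj v (I.nb v i) := by
  simpa [nb, h] using I.N.adj_nbr v ⟨i, h⟩

theorem exists_nb {v y : I.V} (h : I.N.graph.Adj v y) : ∃ i < I.N.deg v, I.nb v i = y := by
  refine ⟨(I.N.port v).symm ⟨y, h⟩, Fin.is_lt _, ?_⟩
  simp [nb, Network.nbr]

theorem nb_inj {v : I.V} {i k : ℕ} (hi : i < I.N.deg v) (hk : k < I.N.deg v)
    (h : I.nb v i = I.nb v k) : i = k := by
  simp only [nb, hi, hk, dif_pos, Network.nbr] at h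
  simpa using (I.N.port v).injective (Subtype.ext h)

theorem exists_port_iff {v : I.V} {Q : I.V → Prop} :
    (∃ i, i < I.N.deg v ∧ Q (I.nb v i)) ↔ ∃ y, I.N.graph.Adj v y ∧ Q y := by
  constructor
  · rintro ⟨i, hi, hQ⟩
    exact ⟨_, I.adj_nb hi, hQ⟩
  · rintro ⟨y, hy, hQ⟩
    obtain ⟨i, hi, rfl⟩ := I.exists_nb hy
    exact ⟨i, hi, hQ⟩

theorem sum_ports {v : I.V} (f : I.V → ℕ) :
    ∑ i ∈ Finset.range (I.N.deg v), f (I.nb v i) =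
      ∑ y, if I.N.graph.Adj v y then f y else 0 := by
  rw [← Finset.sum_filter]
  refine Finset.sum_bij (fun i _ => I.nb v i) ?_ ?_ ?_ ?_
  · intro i hi
    simpa using I.adj_nb (Finset.mem_range.1 hi)
  · intro i hi k hk h
    exact I.nb_inj (Finset.mem_range.1 hi) (Finset.mem_range.1 hk) h
  · intro y hy
    obtain ⟨i, hi, h⟩ := I.exists_nb (Finset.mem_filter.1 hy).2
    exact ⟨i, Finset.mem_range.2 hi, h⟩
  · intro i _
    rfl

/-- All nodes execute their programs, which end after exactly `τ` rounds with the values `f`. -/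
inductive Runs {α : Type} : ℕ → (I.V → NodeProgram α) → (I.V → α) → Prop
  | done (f : I.V → α) : Runs 0 (fun v => .done (f v)) f
  | round {τ : ℕ} {f : I.V → α} (b : I.V → Bool) (k : I.V → (ℕ → Bool) → NodeProgram α)
      (h : Runs τ (fun v => k v (I.received b v)) f) : Runs (τ + 1) (fun v => .round (b v) (k v)) f

variable {I}

/-- All nodes end the first program in the same round, so the second one starts synchronously; no
node has to know the duration. -/
theorem Runs.bind {α β : Type} {τ τ' : ℕ} {p : I.V → NodeProgram α} {f : I.V → α}
    {q : I.V → α → NodeProgram β} {g : I.V → β} (hp : I.Runs τ p f)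
    (hq : I.Runs τ' (fun v => q v (f v)) g) : I.Runs (τ + τ') (fun v => (p v).bind (q v)) g := by
  induction hp with
  | done f => simpa [NodeProgram.bind] using hq
  | round b k h ih =>
    rw [Nat.add_right_comm]
    exact Runs.round b (fun v x => (k v x).bind (q v)) (ih hq)

end RootedNetwork

open RootedNetwork

/-! ### A calculus of distributed computability with round bounds. -/

/-- A quantity attached to the nodes of all networks. -/
abbrev NodeField (α : Type) := ∀ I : RootedNetwork, I.V → α

/-- On the networks with property `P`, if every node `v` knows `F I v`, then every node `v` can
compute `G I v` within `τ` rounds. -/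
def Computes {α β : Type} (P : RootedNetwork → Prop) (τ : ℕ) (F : NodeField α)
    (G : NodeField β) : Prop :=
  ∃ p : α → NodeProgram β, ∀ I, P I → ∃ τ' ≤ τ, I.Runs τ' (fun v => p (F I v)) (G I)

namespace Computes

variable {α β γ σ : Type} {P : RootedNetwork → Prop} {τ τ' : ℕ} {F : NodeField α}
  {G : NodeField β} {H : NodeField γ}

theorem local' (g : α → β) (h : ∀ I, P I → ∀ v, G I v = g (F I v)) : Computes P 0 F G := by
  refine ⟨fun a => .done (g a), fun I hI => ⟨0, le_rfl, ?_⟩⟩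
  have : G I = fun v => g (F I v) := funext (h I hI)
  rw [this]
  exact Runs.done _

theorem mono (h : Computes P τ F G) (hτ : τ ≤ τ') : Computes P τ' F G := by
  obtain ⟨p, hp⟩ := h
  refine ⟨p, fun I hI => ?_⟩
  obtain ⟨t, ht, hr⟩ := hp I hI
  exact ⟨t, ht.trans hτ, hr⟩

theorem trans (h : Computes P τ F G) (h' : Computes P τ' G H) : Computes P (τ + τ') F H := by
  obtain ⟨p, hp⟩ := h
  obtain ⟨q, hq⟩ := h'
  refine ⟨fun a => (p a).bind q, fun I hI => ?_⟩
  obtain ⟨t, ht, hr⟩ := hp I hI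
  obtain ⟨t', ht', hr'⟩ := hq I hI
  exact ⟨t + t', Nat.add_le_add ht ht', hr.bind (q := fun _ => q) hr'⟩

theorem restrict {P' : RootedNetwork → Prop} (h : Computes P τ F G) (hP : ∀ I, P' I → P I) :
    Computes P' τ F G := by
  obtain ⟨p, hp⟩ := h
  exact ⟨p, fun I hI => hp I (hP I hI)⟩

/-- Postcomposition with a local computation. -/
theorem map (h : Computes P τ F G) (g : β → γ) (hg : ∀ I, P I → ∀ v, H I v = g (G I v)) :
    Computes P τ F H := by
  simpa using h.trans (local' g hg)

/-- Precomposition with a local computation. -/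
theorem comap (h : Computes P τ G H) (g : α → β) (hg : ∀ I, P I → ∀ v, G I v = g (F I v)) :
    Computes P τ F H := by
  simpa using (local' g hg).trans h

/-- A case distinction on which all nodes agree. -/
theorem cases (c : α → Prop) (hc : ∀ I, P I → ∀ v w, c (F I v) → c (F I w))
    (h : Computes (fun I => P I ∧ ∀ v, c (F I v)) τ F G)
    (h' : Computes (fun I => P I ∧ ∀ v, ¬ c (F I v)) τ F G) : Computes P τ F G := by
  obtain ⟨p, hp⟩ := h
  obtain ⟨q, hq⟩ := h'
  refine ⟨fun a => if c a then p a else q a, fun I hI => ?_⟩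
  by_cases hcc : ∃ v, c (F I v)
  · obtain ⟨v, hv⟩ := hcc
    have hall : ∀ w, c (F I w) := fun w => hc I hI v w hv
    simpa [hall] using hp I ⟨hI, hall⟩
  · push Not at hcc
    simpa [hcc] using hq I ⟨hI, hcc⟩

theorem exchange_bit (b : α → Bool) :
    Computes P 1 F fun I v => (F I v, I.received (fun u => b (F I u)) v) := by
  refine ⟨fun a => .round (b a) fun x => .done (a, x), fun I _ => ⟨1, le_rfl, ?_⟩⟩
  exact Runs.round (fun v => b (F I v)) (fun v x => .done (F I v, x)) (Runs.done _)

theorem iterate {Y : ℕ → NodeField σ} {m : ℕ} (n : ℕ)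
    (h : ∀ t < n, Computes P m (Y t) (Y (t + 1))) : Computes P (n * m) (Y 0) (Y n) := by
  induction n with
  | zero => exact (local' id fun _ _ _ => rfl).mono (Nat.zero_le _)
  | succ n ih =>
    rw [Nat.succ_mul]
    exact (ih fun t ht => h t (by omega)).trans (h n (by omega))

/-- The exchange of numbers with at most `m` bits. -/
theorem exchange (m : ℕ) (a : α → ℕ) (ha : ∀ I, P I → ∀ v, a (F I v) < 2 ^ m) :
    Computes P m F fun I v => (F I v, I.received (fun u => a (F I u)) v) := by
  have key : Computes P (m * 1)
      (fun I v => (F I v, I.received (fun u => a (F I u) % 2 ^ 0) v))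
      (fun I v => (F I v, I.received (fun u => a (F I u) % 2 ^ m) v)) := by
    -- After `t` rounds the `t` lowest bits of the neighbours' numbers are known.
    refine iterate (Y := fun t I v => (F I v, I.received (fun u => a (F I u) % 2 ^ t) v)) m
      fun t _ => ?_
    refine (exchange_bit fun s => (a s.1).testBit t).map
      (fun s => (s.1.1, fun i => s.1.2 i + 2 ^ t * (s.2 i).toNat)) fun I _ v => ?_
    refine Prod.ext rfl (funext fun i => ?_)
    by_cases hi : i < I.N.deg v
    · simp [received, hi, Nat.mod_pow_succ, Nat.toNat_testBit]
    · simp [received, hi]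
  rw [Nat.mul_one] at key
  refine (key.comap (fun s => (s, fun _ => 0)) fun I _ v => ?_).map id fun I hI v => ?_
  · refine Prod.ext rfl (funext fun i => ?_)
    simp [received, Nat.mod_one]
  · simp [Nat.mod_eq_of_lt (ha I hI _)]

/-- A loop in each pass of which every node sends a number of at most `m` bits. -/
theorem loop {Y : ℕ → NodeField σ} {m : ℕ} (n : ℕ) (a : ℕ → σ → ℕ)
    (upd : ℕ → σ → (ℕ → ℕ) → σ) (ha : ∀ t < n, ∀ I, P I → ∀ v, a t (Y t I v) < 2 ^ m)
    (hY : ∀ t < n, ∀ I, P I → ∀ v,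
      Y (t + 1) I v = upd t (Y t I v) (I.received (fun u => a t (Y t I u)) v)) :
    Computes P (n * m) (Y 0) (Y n) :=
  iterate n fun t ht => (exchange m (a t) (ha t ht)).map (fun s => upd t s.1 s.2) (hY t ht)

end Computes

/-! ### Parent maps -/

/-- A tree with nodes `V` given by its root and the map that takes a node to its parent (and the
root to itself). -/
structure ParentMap (V : Type) where
  par : V → V
  root : V
  par_root : par root = root
  reach : ∀ v, ∃ i, par^[i] v = root

namespace ParentMap

variable {V : Type} (F : ParentMap V)

/-- The distance from the root. -/
def depth (v : V) : ℕ := Nat.find (F.reach v)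

/-- `x` is an ancestor of `y`, or `y` itself. -/
def Anc (x y : V) : Prop := ∃ i, F.par^[i] y = x

/-- `y` is a child of `x`. -/
def Child (x y : V) : Prop := y ≠ F.root ∧ F.par y = x

theorem iterate_root (i : ℕ) : F.par^[i] F.root = F.root :=
  Function.iterate_fixed F.par_root i

theorem iterate_eq_root_iff {v : V} {i : ℕ} : F.par^[i] v = F.root ↔ F.depth v ≤ i := by
  constructor
  · exact fun h => Nat.find_min' _ h
  · intro h
    obtain ⟨k, rfl⟩ := Nat.exists_eq_add_of_le' h
    rw [Function.iterate_add_apply, show F.par^[F.depth v] v = F.root from Nat.find_spec (F.reach v),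
      F.iterate_root]

theorem iterate_depth (v : V) : F.par^[F.depth v] v = F.root := F.iterate_eq_root_iff.2 le_rfl

theorem depth_eq_zero_iff {v : V} : F.depth v = 0 ↔ v = F.root := by
  rw [← Nat.le_zero, ← F.iterate_eq_root_iff]
  rfl

theorem depth_iterate (v : V) (i : ℕ) : F.depth (F.par^[i] v) = F.depth v - i := by
  apply le_antisymm
  · rw [← F.iterate_eq_root_iff, ← Function.iterate_add_apply, F.iterate_eq_root_iff]
    omega
  · have h := F.iterate_depth (F.par^[i] v)
    rw [← Function.iterate_add_apply, F.iterate_eq_root_iff] at h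
    omega

theorem depth_par (v : V) : F.depth (F.par v) = F.depth v - 1 := F.depth_iterate v 1

theorem depth_par_add_one {v : V} (h : v ≠ F.root) : F.depth (F.par v) + 1 = F.depth v := by
  have := mt F.depth_eq_zero_iff.1 h
  rw [F.depth_par]
  omega

theorem anc_refl (v : V) : F.Anc v v := ⟨0, rfl⟩

theorem anc_root (v : V) : F.Anc F.root v := F.reach v

theorem anc_iterate (v : V) (i : ℕ) : F.Anc (F.par^[i] v) v := ⟨i, rfl⟩

variable {F}

theorem Anc.trans {x y z : V} (h : F.Anc x y) (h' : F.Anc y z) : F.Anc x z := by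
  obtain ⟨i, rfl⟩ := h
  obtain ⟨k, rfl⟩ := h'
  exact ⟨i + k, Function.iterate_add_apply _ _ _ _⟩

theorem Anc.iterate_eq {x y : V} (h : F.Anc x y) : F.par^[F.depth y - F.depth x] y = x := by
  obtain ⟨i, rfl⟩ := h
  rw [F.depth_iterate]
  by_cases hi : i ≤ F.depth y
  · rw [Nat.sub_sub_self hi]
  -- Here `i` overshoots the root, which `par` fixes, so the ancestor is the root.
  · rw [F.iterate_eq_root_iff.2 (by omega : F.depth y ≤ i), F.iterate_eq_root_iff]
    omega

theorem Anc.depth_le {x y : V} (h : F.Anc x y) : F.depth x ≤ F.depth y := by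
  obtain ⟨i, rfl⟩ := h
  rw [F.depth_iterate]
  omega

theorem Anc.eq_of_depth_le {x y : V} (h : F.Anc x y) (hd : F.depth y ≤ F.depth x) : x = y := by
  have := h.iterate_eq
  rw [Nat.sub_eq_zero_of_le hd] at this
  exact this.symm

/-- Two ancestors of a node are comparable. -/
theorem Anc.comparable {x y z : V} (h : F.Anc x z) (h' : F.Anc y z)
    (hd : F.depth x ≤ F.depth y) : F.Anc x y := by
  refine ⟨F.depth y - F.depth x, ?_⟩
  have := h'.depth_le
  calc F.par^[F.depth y - F.depth x] y
      = F.par^[F.depth y - F.depth x] (F.par^[F.depth z - F.depth y] z) := by rw [h'.iterate_eq]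
    _ = F.par^[F.depth z - F.depth x] z := by
      rw [← Function.iterate_add_apply]
      congr 2
      omega
    _ = x := h.iterate_eq

theorem Anc.eq {x y z : V} (h : F.Anc x z) (h' : F.Anc y z)
    (hd : F.depth x = F.depth y) : x = y :=
  (h.comparable h' hd.le).eq_of_depth_le hd.ge

theorem anc_child {x z y : V} (hz : F.Child x z) (h : F.Anc z y) : F.Anc x y :=
  Anc.trans ⟨1, hz.2⟩ h

theorem Child.depth {x z : V} (hz : F.Child x z) : F.depth z = F.depth x + 1 := by
  rw [← hz.2, F.depth_par_add_one hz.1]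

/-- A proper descendant is a descendant of a child. -/
theorem Anc.exists_child {x y : V} (h : F.Anc x y) (hne : y ≠ x) :
    F.Child x (F.par^[F.depth y - F.depth x - 1] y) := by
  have hlt : F.depth x < F.depth y := by
    by_contra hle
    exact hne (h.eq_of_depth_le (by omega)).symm
  constructor
  · rw [Ne, F.iterate_eq_root_iff]
    omega
  · have := h.iterate_eq
    rw [← Function.iterate_succ_apply' F.par]
    rwa [show (F.depth y - F.depth x - 1).succ = F.depth y - F.depth x by omega]

variable (F)

theorem anc_iff_eq_or_par {x y : V} : F.Anc x y ↔ x = y ∨ F.Anc x (F.par y) := by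
  constructor
  · rintro ⟨i, rfl⟩
    cases i with
    | zero => exact Or.inl rfl
    | succ i => exact Or.inr ⟨i, (Function.iterate_succ_apply _ _ _).symm⟩
  · rintro (rfl | ⟨i, rfl⟩)
    · exact F.anc_refl _
    · exact ⟨i + 1, Function.iterate_succ_apply _ _ _⟩

/-! ### Pipelined sums towards the root of a tree. -/

section Upcast

variable [Fintype V]

/-- The number that `x` sends in round `t` if every node `y` injects `own y t` in round `t` and
every node adds what its children sent in the previous round. -/
def upcast (own : V → ℕ → ℕ) (t : ℕ) (x : V) : ℕ :=
  ∑ y, if F.Anc x y ∧ F.depth y - F.depth x ≤ t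
    then own y (t - (F.depth y - F.depth x)) else 0

theorem upcast_zero (own : V → ℕ → ℕ) (x : V) : F.upcast own 0 x = own x 0 := by
  unfold upcast
  rw [Finset.sum_eq_single x]
  · simp [F.anc_refl]
  · intro y _ hy
    rw [if_neg]
    rintro ⟨h, hd⟩
    exact hy (h.eq_of_depth_le (by omega)).symm
  · simp

/-- A proper descendant of `x` lies below exactly one child of `x`, and is one step closer to that
child; so its contribution passed the child one round earlier. -/
theorem upcast_succ (own : V → ℕ → ℕ) (t : ℕ) (x : V) :
    F.upcast own (t + 1) x =
      own x (t + 1) + ∑ z, if F.Child x z then F.upcast own t z else 0 := by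
  have h1 : ∀ z, (if F.Child x z then F.upcast own t z else 0) =
      ∑ y, if F.Child x z ∧ F.Anc z y ∧ F.depth y - F.depth z ≤ t
        then own y (t - (F.depth y - F.depth z)) else 0 := by
    intro z
    by_cases hz : F.Child x z <;> simp [hz, upcast]
  simp only [h1]
  rw [Finset.sum_comm, upcast, ← Finset.add_sum_erase _ _ (Finset.mem_univ x)]
  have h2 := Finset.sum_erase (a := x) Finset.univ
    (f := fun y => ∑ z, if F.Child x z ∧ F.Anc z y ∧ F.depth y - F.depth z ≤ t
      then own y (t - (F.depth y - F.depth z)) else 0) <| by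
    refine Finset.sum_eq_zero fun z _ => if_neg ?_
    rintro ⟨hz, h, -⟩
    have := h.depth_le
    have := hz.depth
    omega
  rw [← h2]
  congr 1
  · simp [F.anc_refl]
  · refine Finset.sum_congr rfl fun y hy => ?_
    have hyx : y ≠ x := Finset.ne_of_mem_erase hy
    by_cases hxy : F.Anc x y
    · have hc := hxy.exists_child hyx
      rw [Finset.sum_eq_single (F.par^[F.depth y - F.depth x - 1] y)]
      · have hd := hc.depth
        have := (F.anc_iterate y (F.depth y - F.depth x - 1)).depth_le
        simp only [hxy, hc, F.anc_iterate, true_and, hd]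
        rw [hd] at this
        refine if_congr (by omega) (congrArg _ (by omega)) rfl
      · intro z _ hz
        rw [if_neg]
        rintro ⟨hxz, hzy, -⟩
        exact hz (hzy.eq (F.anc_iterate y _) (by rw [hxz.depth, hc.depth]))
      · simp
    · rw [if_neg (fun h => hxy h.1), Finset.sum_eq_zero]
      intro z _
      exact if_neg fun h => hxy (anc_child h.1 h.2.1)

theorem upcast_le {own : V → ℕ → ℕ} {B : ℕ} (h : ∀ y t, own y t ≤ B) (t : ℕ) (x : V) :
    F.upcast own t x ≤ Fintype.card V * B := by
  unfold upcast
  calc _ ≤ ∑ _y : V, B := Finset.sum_le_sum fun y _ => by split_ifs <;> simp [h]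
    _ = _ := by simp

end Upcast

/-! ### Ruling sets -/

/-- The distance of `v` and `u` in the tree is at most `d`. -/
def Near (d : ℕ) (v u : V) : Prop := ∃ i k, i + k ≤ d ∧ F.par^[i] v = F.par^[k] u

variable {F}

/-- Both meeting points are ancestors of `u`; the higher one is a common ancestor of `v` and `w`. -/
theorem Near.trans {d e : ℕ} {v u w : V} (h : F.Near d v u) (h' : F.Near e u w) :
    F.Near (d + e) v w := by
  obtain ⟨i, k, hik, h⟩ := h
  obtain ⟨i', k', hik', h'⟩ := h'
  rcases le_total k i' with hk | hk
  · refine ⟨i' - k + i, k', by omega, ?_⟩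
    rw [Function.iterate_add_apply, h, ← Function.iterate_add_apply, Nat.sub_add_cancel hk, h']
  · refine ⟨i, k - i' + k', by omega, ?_⟩
    rw [Function.iterate_add_apply, ← h', ← Function.iterate_add_apply, Nat.sub_add_cancel hk, h]

theorem Near.mono {d e : ℕ} {v u : V} (h : F.Near d v u) (hd : d ≤ e) : F.Near e v u := by
  obtain ⟨i, k, hik, h⟩ := h
  exact ⟨i, k, hik.trans hd, h⟩

theorem Near.symm {d : ℕ} {v u : V} (h : F.Near d v u) : F.Near d u v := by
  obtain ⟨i, k, hik, h⟩ := h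
  exact ⟨k, i, by omega, h.symm⟩

variable (F)

theorem near_refl (d : ℕ) (v : V) : F.Near d v v := ⟨0, 0, by omega, rfl⟩

theorem near_zero_iff {v u : V} : F.Near 0 v u ↔ v = u := by
  constructor
  · rintro ⟨i, k, hik, h⟩
    obtain ⟨rfl, rfl⟩ : i = 0 ∧ k = 0 := by omega
    exact h
  · rintro rfl
    exact F.near_refl 0 v

/-- This lets balls of the tree metric be explored by flooding, one tree edge per pass. A step taken
at the root does not move, so it can be dropped from the budget. -/
theorem near_succ_iff {d : ℕ} {v u : V} :
    F.Near (d + 1) v u ↔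
      F.Near d v u ∨ ∃ y, (F.Child v y ∨ F.Child y v) ∧ F.Near d y u := by
  constructor
  · rintro ⟨i, k, hik, h⟩
    by_cases hd : i + k ≤ d
    · exact Or.inl ⟨i, k, hd, h⟩
    cases i with
    | succ i =>
      by_cases hv : v = F.root
      · left
        refine ⟨i, k, by omega, ?_⟩
        rw [← h, hv, F.iterate_root, F.iterate_root]
      · exact Or.inr ⟨F.par v, Or.inr ⟨hv, rfl⟩, i, k, by omega,
          by rw [← h, Function.iterate_succ_apply]⟩
    | zero =>
      cases k with
      | zero => omega
      | succ k =>
        rw [Function.iterate_succ_apply'] at h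
        by_cases hy : F.par^[k] u = F.root
        · left
          refine ⟨0, k, by omega, ?_⟩
          rw [h, hy, F.par_root]
        · exact Or.inr ⟨F.par^[k] u, Or.inl ⟨hy, h.symm⟩, 0, k, by omega, rfl⟩
  · rintro (h | ⟨y, hy, h⟩)
    · exact h.mono (Nat.le_succ d)
    · rw [Nat.add_comm]
      refine Near.trans (u := y) ?_ h
      rcases hy with hy | hy
      · exact ⟨0, 1, le_rfl, hy.2.symm⟩
      · exact ⟨1, 0, le_rfl, hy.2⟩

/-- The candidates for a ruling set that remain after `i` rounds of elimination: in each round, a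
candidate whose identifier has the current bit `1` is eliminated if it is near to a candidate whose
identifier has the bit `0`. -/
def Cand (uid : V → ℕ) (α : ℕ) : ℕ → V → Prop
  | 0, _ => True
  | i + 1, v => Cand uid α i v ∧ ((uid v).testBit i = true →
      ¬ ∃ u, (Cand uid α i u ∧ (uid u).testBit i = false) ∧ F.Near α v u)

variable {F} {uid : V → ℕ} {α : ℕ}

theorem Cand.anti {i k : ℕ} {v : V} (h : F.Cand uid α k v) (hi : i ≤ k) : F.Cand uid α i v := by
  induction k with
  | zero =>
    obtain rfl : i = 0 := by omega
    exact h
  | succ k ih =>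
    rcases Nat.lt_or_ge k i with hk | hk
    · obtain rfl : i = k + 1 := by omega
      exact h
    · exact ih h.1 hk

/-- An eliminated candidate has near it a candidate with bit `0`, which survives that round; each
round therefore adds at most `α` to the distance. -/
theorem exists_cand_near (i : ℕ) (v : V) : ∃ u, F.Cand uid α i u ∧ F.Near (α * i) v u := by
  induction i with
  | zero => exact ⟨v, trivial, F.near_refl _ v⟩
  | succ i ih =>
    obtain ⟨u, hu, hvu⟩ := ih
    by_cases h : F.Cand uid α (i + 1) u
    · exact ⟨u, h, hvu.mono (Nat.mul_le_mul_left _ (Nat.le_succ i))⟩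
    · have h' : ∃ w, (F.Cand uid α i w ∧ (uid w).testBit i = false) ∧ F.Near α u w := by
        by_contra hc
        exact h ⟨hu, fun _ => hc⟩
      obtain ⟨w, ⟨hw, hb⟩, huw⟩ := h'
      exact ⟨w, ⟨hw, by simp [hb]⟩, hvu.trans huw⟩

/-- Distinct identifiers differ in some bit `i < b`. If two near nodes were both candidates before
round `i`, that round would eliminate the one with bit `1`. -/
theorem cand_independent (hinj : Function.Injective uid) {b : ℕ} (hb : ∀ v, uid v < 2 ^ b)
    {u v : V} (hu : F.Cand uid α b u) (hv : F.Cand uid α b v) (h : F.Near α u v) : u = v := by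
  by_contra hne
  obtain ⟨i, hi⟩ : ∃ i, (uid u).testBit i ≠ (uid v).testBit i := by
    by_contra hc
    push Not at hc
    exact hne (hinj (Nat.eq_of_testBit_eq hc))
  have hib : i < b := by
    by_contra hc
    have h2 : ∀ w, (uid w).testBit i = false := fun w =>
      Nat.testBit_lt_two_pow ((hb w).trans_le (Nat.pow_le_pow_right (by norm_num) (by omega)))
    simp [h2] at hi
  have hu' : F.Cand uid α (i + 1) u := hu.anti hib
  have hv' : F.Cand uid α (i + 1) v := hv.anti hib
  cases hub : (uid u).testBit i <;> cases hvb : (uid v).testBit i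
  · simp [hub, hvb] at hi
  · exact hv'.2 hvb ⟨u, ⟨hu'.1, hub⟩, h.symm⟩
  · exact hu'.2 hub ⟨v, ⟨hv'.1, hvb⟩, h⟩
  · simp [hub, hvb] at hi

/-- A set of nodes with pairwise distances greater than `2 d` is small. -/
theorem card_mul_le_of_independent [Fintype V] {d : ℕ} (S : Finset V)
    (hS : ∀ u ∈ S, ∀ v ∈ S, F.Near (2 * d) u v → u = v) :
    (S.card - 1) * (d + 1) ≤ Fintype.card V := by
  -- Two nodes of depth below `d` meet at the root, within distance `2 * d`.
  have h1 : (S.filter fun s => ¬ d ≤ F.depth s).card ≤ 1 := by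
    rw [Finset.card_le_one]
    intro u hu v hv
    rw [Finset.mem_filter] at hu hv
    refine hS u hu.1 v hv.1 ⟨F.depth u, F.depth v, by omega, ?_⟩
    rw [F.iterate_depth, F.iterate_depth]
  -- Each deeper node owns the `d + 1` nodes that start its path to the root; a node owned twice
  -- would put the two owners within `2 * d`.
  have h2 : (S.filter fun s => d ≤ F.depth s).card * (d + 1) ≤ Fintype.card V := by
    rw [← Finset.card_range (d + 1), ← Finset.card_product, ← Finset.card_univ]
    refine Finset.card_le_card_of_injOn (fun x => F.par^[x.2] x.1) (fun _ _ => by simp) ?_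
    rintro ⟨u, i⟩ hu ⟨v, k⟩ hv h
    simp only [Finset.coe_product, Set.mem_prod, Finset.mem_coe, Finset.mem_filter,
      Finset.mem_range] at hu hv h
    obtain rfl : u = v := hS u hu.1.1 v hv.1.1 ⟨i, k, by omega, h⟩
    have h3 := congrArg F.depth h
    rw [F.depth_iterate, F.depth_iterate] at h3
    obtain rfl : i = k := by omega
    rfl
  have h3 := Finset.card_filter_add_card_filter_not (s := S) (p := fun s => d ≤ F.depth s)
  exact (Nat.mul_le_mul_right _ (by omega)).trans h2

end ParentMap

namespace ParentMap

variable {V : Type} (F : ParentMap V)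

/-! ### Skeletons -/

/-- `v` has a descendant in `S₀`. -/
def Hit (S₀ : V → Prop) (v : V) : Prop := ∃ u, S₀ u ∧ F.Anc v u

/-- The nodes of `S₀`, the root, and the branching points of the tree spanned by them. -/
def Closure (S₀ : V → Prop) (v : V) : Prop :=
  v = F.root ∨ S₀ v ∨
    ∃ c c', c ≠ c' ∧ (F.Child v c ∧ F.Hit S₀ c) ∧ (F.Child v c' ∧ F.Hit S₀ c')

variable {F} {S₀ S : V → Prop} {A : ℕ}

theorem Hit.of_anc {v w : V} (h : F.Hit S₀ w) (hv : F.Anc v w) : F.Hit S₀ v := by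
  obtain ⟨u, hu, h⟩ := h
  exact ⟨u, hu, hv.trans h⟩

theorem Closure.hit {v c : V} (h : F.Closure S₀ v) (hc : c ≠ F.root) (hv : F.Anc c v) :
    F.Hit S₀ c := by
  rcases h with rfl | h | ⟨d, _, _, ⟨hd, h⟩, _⟩
  · have := hv.depth_le
    rw [F.depth_eq_zero_iff.2 rfl, Nat.le_zero, F.depth_eq_zero_iff] at this
    exact (hc this).elim
  · exact ⟨v, h, hv⟩
  · exact (h.of_anc (Anc.trans hv ⟨1, hd.2⟩))

/-- Below a non-root node, a closure node entails a node of `S₀`. Two different children with this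
property would make `v` a branching point. -/
theorem Closure.branch {v c c' s s' : V} (hv : ¬ F.Closure S₀ v) (hc : F.Child v c)
    (hc' : F.Child v c') (hs : F.Closure S₀ s) (hs' : F.Closure S₀ s') (h : F.Anc c s)
    (h' : F.Anc c' s') : c = c' := by
  by_contra hne
  exact hv (Or.inr (Or.inr ⟨c, c', hne, ⟨hc, hs.hit hc.1 h⟩, ⟨hc', hs'.hit hc'.1 h'⟩⟩))

/-- If `S₀` is dominating, then the descendants of a node in `S₀` can be found close to it. -/
theorem Hit.exists_near (hdom : ∀ v, ∃ u, S₀ u ∧ F.Near A v u) {v : V} (h : F.Hit S₀ v) :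
    ∃ u, S₀ u ∧ F.Anc v u ∧ F.depth u - F.depth v ≤ 2 * A + 1 := by
  obtain ⟨u, hu, h⟩ := h
  by_cases hd : F.depth u - F.depth v ≤ 2 * A + 1
  · exact ⟨u, hu, h, hd⟩
  -- Domination is applied to the node `A + 1` levels below `v` on the path to `u`: at most `A`
  -- steps up from there the path is still strictly below `v`, so `w` is a descendant of `v`.
  obtain ⟨w, hw, i, k, hik, he⟩ := hdom (F.par^[F.depth u - F.depth v - (A + 1)] u)
  have hx : F.par^[A + 1] (F.par^[F.depth u - F.depth v - (A + 1)] u) = v := by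
    rw [← Function.iterate_add_apply]
    conv_rhs => rw [← h.iterate_eq]
    congr 2
    omega
  have hvw : F.par^[A + 1 - i + k] w = v := by
    rw [Function.iterate_add_apply, ← he, ← Function.iterate_add_apply,
      Nat.sub_add_cancel (by omega), hx]
  refine ⟨w, hw, ⟨_, hvw⟩, ?_⟩
  have := F.depth_iterate w (A + 1 - i + k)
  rw [hvw] at this
  omega

/-- Domination at `v` shows that all its ancestors from index `A` on have a node of `S₀` below them.
Domination at the ancestor of index `2 * A + 1` gives `u'` in `S₀`, whose path to the root joins
that of `v` at an index `m` with `A < m ≤ 3 * A + 1`. The joining point is `u'` itself or has two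
children leading to `S₀`, one towards `v` and one towards `u'`. -/
theorem exists_closure_iterate (hdom : ∀ v, ∃ u, S₀ u ∧ F.Near A v u) (v : V) :
    ∃ i ≤ 3 * A + 1, F.Closure S₀ (F.par^[i] v) := by
  by_contra hno
  push Not at hno
  have hdv : 3 * A + 1 < F.depth v := by
    by_contra hd
    exact hno (3 * A + 1) le_rfl (Or.inl (F.iterate_eq_root_iff.2 (by omega)))
  obtain ⟨u, hu, i, k, hik, he⟩ := hdom v
  have hhit : ∀ m, i ≤ m → F.Hit S₀ (F.par^[m] v) := by
    intro m hm
    have h1 : F.Hit S₀ (F.par^[i] v) := ⟨u, hu, k, he.symm⟩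
    refine h1.of_anc ⟨m - i, ?_⟩
    rw [← Function.iterate_add_apply, Nat.sub_add_cancel hm]
  obtain ⟨u', hu', i', k', hik', he'⟩ := hdom (F.par^[2 * A + 1] v)
  rw [← Function.iterate_add_apply] at he'
  have hex : ∃ m, F.Anc (F.par^[m] v) u' := ⟨_, k', he'.symm⟩
  set m := Nat.find hex with hm
  have hmu : F.Anc (F.par^[m] v) u' := Nat.find_spec hex
  have hm1 : m ≤ i' + (2 * A + 1) := Nat.find_min' hex ⟨k', he'.symm⟩
  have hd1 := hmu.depth_le
  have hd2 := congrArg F.depth he'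
  simp only [F.depth_iterate] at hd1 hd2
  -- `u'` is at most `A` levels deeper than the ancestor of `v` with index `2 * A + 1`, so the paths
  -- cannot join earlier.
  have hmA : A + 1 ≤ m := by omega
  have hnS := hno m (by omega)
  have hne : u' ≠ F.par^[m] v := fun h => hnS (Or.inr (Or.inl (h ▸ hu')))
  have hc := hmu.exists_child hne
  refine hnS (Or.inr (Or.inr ⟨F.par^[m - 1] v, _, ?_, ⟨⟨?_, ?_⟩, hhit _ (by omega)⟩,
    hc, u', hu', F.anc_iterate _ _⟩))
  · intro h
    refine Nat.find_min hex (m := m - 1) (by omega) ?_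
    rw [h]
    exact F.anc_iterate _ _
  · intro h
    exact hno (m - 1) (by omega) (Or.inl h)
  · rw [← Function.iterate_succ_apply' F.par]
    congr 2
    omega

variable (F S₀) in
-- The nodes with a descendant in `S₀` form a tree whose leaves are in `S₀`, and a tree has no more
-- branching points than leaves.
theorem card_closure_le [Fintype V] :
    (Finset.univ.filter (F.Closure S₀)).card ≤ 2 * (Finset.univ.filter S₀).card + 1 := by
  set H := Finset.univ.filter (F.Hit S₀)
  let ch : V → Finset V := fun v => Finset.univ.filter fun c => F.Child v c ∧ F.Hit S₀ c
  have h1 : ∑ v ∈ H, (ch v).card ≤ H.card := by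
    rw [← Finset.card_biUnion]
    · refine Finset.card_le_card fun c hc => ?_
      simp only [ch, H, Finset.mem_biUnion, Finset.mem_filter, Finset.mem_univ, true_and] at hc ⊢
      obtain ⟨_, _, _, h⟩ := hc
      exact h
    · intro v _ w _ hvw
      rw [Function.onFun, Finset.disjoint_left]
      intro c hc hc'
      simp only [ch, Finset.mem_filter, Finset.mem_univ, true_and] at hc hc'
      exact hvw (hc.1.2.symm.trans hc'.1.2)
  -- Summed over `H`, the terms `1` and the numbers of children cancel by `h1`; what remains bounds
  -- the number of branching points.
  have h2 : ∀ v ∈ H, 1 + (if 2 ≤ (ch v).card then 1 else 0) ≤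
      (ch v).card + if S₀ v then 1 else 0 := by
    intro v hv
    obtain ⟨u, hu, huv⟩ := (Finset.mem_filter.1 hv).2
    by_cases hS : S₀ v
    · simp only [hS, if_true]
      split_ifs <;> omega
    · have hne : u ≠ v := fun h => hS (h ▸ hu)
      have : 0 < (ch v).card := Finset.card_pos.2 ⟨_, Finset.mem_filter.2
        ⟨Finset.mem_univ _, huv.exists_child hne, u, hu, F.anc_iterate _ _⟩⟩
      simp only [hS, if_false]
      split_ifs <;> omega
  have h3 := Finset.sum_le_sum h2
  rw [Finset.sum_add_distrib, Finset.sum_add_distrib, ← Finset.card_filter,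
    Finset.sum_const, smul_eq_mul, mul_one] at h3
  have h4 : Finset.univ.filter (F.Closure S₀) ⊆
      insert F.root (Finset.univ.filter S₀ ∪ H.filter fun v => 2 ≤ (ch v).card) := by
    intro v hv
    rcases (Finset.mem_filter.1 hv).2 with rfl | h | ⟨c, c', hne, hc, hc'⟩
    · simp
    · simp [h]
    · refine Finset.mem_insert_of_mem (Finset.mem_union_right _ (Finset.mem_filter.2
        ⟨Finset.mem_filter.2 ⟨Finset.mem_univ _, hc.2.of_anc ⟨1, hc.1.2⟩⟩, ?_⟩))
      exact Finset.one_lt_card.2 ⟨c, by simpa [ch] using hc, c', by simpa [ch] using hc', hne⟩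
  have h5 := (Finset.card_le_card h4).trans (Finset.card_insert_le _ _)
  have h6 := Finset.card_union_le (Finset.univ.filter S₀) (H.filter fun v => 2 ≤ (ch v).card)
  have h7 : (∑ v ∈ H, if S₀ v then 1 else 0) ≤ (Finset.univ.filter S₀).card := by
    rw [← Finset.card_filter]
    exact Finset.card_le_card (Finset.filter_subset_filter _ (Finset.subset_univ _))
  omega

variable (F) in
/-- A set of nodes that contains the root and is closed under branching points. -/
structure IsSkeleton (S : V → Prop) : Prop where
  root : S F.root
  branch : ∀ {v c c' s s' : V}, ¬ S v → F.Child v c → F.Child v c' → S s → S s' → F.Anc c s →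
    F.Anc c' s' → c = c'

theorem isSkeleton_closure : F.IsSkeleton (F.Closure S₀) :=
  ⟨Or.inl rfl, Closure.branch⟩

variable (F S) in
/-- `s` is a highest node of `S` among the descendants of `v`. -/
def Top (v s : V) : Prop := (S s ∧ F.Anc v s) ∧ ∀ x, F.Anc v x → F.Anc x s → S x → x = s

theorem top_self {v : V} (h : S v) : F.Top S v v :=
  ⟨⟨h, F.anc_refl v⟩, fun _ hx hx' _ => hx'.eq_of_depth_le hx.depth_le⟩

theorem Top.eq_self {v s : V} (h : F.Top S v s) (hv : S v) : s = v :=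
  (h.2 v (F.anc_refl v) h.1.2 hv).symm

theorem exists_top {v s : V} (hs : S s) (h : F.Anc v s) : ∃ s', F.Top S v s' ∧ F.Anc s' s := by
  have hex : ∃ d, ∃ x, S x ∧ F.Anc v x ∧ F.Anc x s ∧ F.depth x = d :=
    ⟨_, s, hs, h, F.anc_refl s, rfl⟩
  obtain ⟨x, hx, hvx, hxs, hd⟩ := Nat.find_spec hex
  refine ⟨x, ⟨⟨hx, hvx⟩, fun y hy hyx hSy => hyx.eq_of_depth_le ?_⟩, hxs⟩
  rw [hd]
  exact Nat.find_min' hex ⟨y, hSy, hy, hyx.trans hxs, rfl⟩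

/-- On the way down from `v`, as long as the current node is outside `S`, closure under branching
forces both paths through the same child. -/
theorem Top.unique (hS : F.IsSkeleton S) {v s s' : V} (h : F.Top S v s) (h' : F.Top S v s') :
    s = s' := by
  induction hn : F.depth s - F.depth v generalizing v with
  | zero =>
    have hv := h.1.2.eq_of_depth_le (by omega)
    exact hv ▸ (h'.eq_self (hv ▸ h.1.1)).symm
  | succ n ih =>
    by_cases hv : S v
    · rw [h.eq_self hv, h'.eq_self hv]
    have hne : s ≠ v := fun e => hv (e ▸ h.1.1)
    have hne' : s' ≠ v := fun e => hv (e ▸ h'.1.1)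
    have hc := h.1.2.exists_child hne
    have hc' := h'.1.2.exists_child hne'
    have he := hS.branch hv hc hc' h.1.1 h'.1.1 (F.anc_iterate _ _) (F.anc_iterate _ _)
    refine ih (v := F.par^[F.depth s - F.depth v - 1] s) ⟨⟨h.1.1, F.anc_iterate _ _⟩, ?_⟩
      ⟨⟨h'.1.1, ?_⟩, ?_⟩ ?_
    · exact fun x hx => h.2 x (anc_child hc hx)
    · rw [he]
      exact F.anc_iterate _ _
    · exact fun x hx => h'.2 x (anc_child hc hx)
    · rw [hc.depth]
      omega

/-- The recursion by which the highest skeleton node is reported upwards, one level per pass. -/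
theorem top_iff_child {v s : V} (hv : ¬ S v) :
    F.Top S v s ↔ ∃ c, F.Child v c ∧ F.Top S c s := by
  constructor
  · intro h
    have hne : s ≠ v := fun e => hv (e ▸ h.1.1)
    have hc := h.1.2.exists_child hne
    exact ⟨_, hc, ⟨h.1.1, F.anc_iterate _ _⟩, fun x hx => h.2 x (anc_child hc hx)⟩
  · rintro ⟨c, hc, h⟩
    refine ⟨⟨h.1.1, anc_child hc h.1.2⟩, fun x hx hxs hSx => ?_⟩
    rcases le_or_gt (F.depth c) (F.depth x) with hd | hd
    · exact h.2 x (h.1.2.comparable hxs hd) hxs hSx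
    · rw [hc.depth] at hd
      have := hx.eq_of_depth_le (by omega)
      exact (hv (this ▸ hSx)).elim

/-- Some node of `S₀` lies this close below `v`. The highest skeleton node on the path to it is no
deeper, and by uniqueness it is `s`. -/
theorem Top.depth_le_closure (hdom : ∀ v, ∃ u, S₀ u ∧ F.Near A v u) {v s : V}
    (h : F.Top (F.Closure S₀) v s) : F.depth s - F.depth v ≤ 2 * A + 1 := by
  by_cases hv : F.Closure S₀ v
  · rw [h.eq_self hv]
    omega
  have hr : v ≠ F.root := fun e => hv (Or.inl e)
  obtain ⟨u, hu, hvu, hd⟩ := (h.1.1.hit hr h.1.2).exists_near hdom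
  obtain ⟨s', hs', hsu⟩ := exists_top (S := F.Closure S₀) (Or.inr (Or.inl hu)) hvu
  rw [h.unique isSkeleton_closure hs']
  have := hsu.depth_le
  omega

/-! ### The lowest skeleton ancestor, and ancestry tests through it. -/

section Sup

variable (hS : F.IsSkeleton S)
include hS

theorem IsSkeleton.exists_iterate (v : V) : ∃ i, S (F.par^[i] v) :=
  ⟨F.depth v, by rw [F.iterate_depth]; exact hS.root⟩

/-- The distance to the lowest ancestor in the skeleton. -/
def IsSkeleton.supDist (v : V) : ℕ := Nat.find (hS.exists_iterate v)

/-- The lowest ancestor in the skeleton. -/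
def IsSkeleton.sup (v : V) : V := F.par^[hS.supDist v] v

end Sup

namespace IsSkeleton

variable (hS : F.IsSkeleton S)

theorem sup_mem (v : V) : S (hS.sup v) := Nat.find_spec (hS.exists_iterate v)

theorem anc_sup (v : V) : F.Anc (hS.sup v) v := F.anc_iterate _ _

theorem supDist_le {v : V} {i : ℕ} (h : S (F.par^[i] v)) : hS.supDist v ≤ i := Nat.find_min' _ h

theorem depth_sup (v : V) : F.depth (hS.sup v) = F.depth v - hS.supDist v := F.depth_iterate _ _

theorem anc_of_supDist_le {v y : V} (h : F.Anc v y) (hd : hS.supDist y ≤ F.depth y - F.depth v) :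
    F.Anc v (hS.sup y) := by
  refine h.comparable (hS.anc_sup y) ?_
  rw [hS.depth_sup]
  have := h.depth_le
  omega

/-- The ancestry test of the algorithm. Either `v` is on the short path from `y` up to the skeleton,
which is settled by listing few ancestors, or the question concerns two skeleton nodes only. -/
theorem anc_iff {v y : V} : F.Anc v y ↔
    (∃ k ≤ hS.supDist y, F.par^[k] y = v) ∨ ∃ s, F.Top S v s ∧ F.Anc s (hS.sup y) := by
  constructor
  · intro h
    rcases le_total (F.depth y - F.depth v) (hS.supDist y) with hd | hd
    · exact Or.inl ⟨_, hd, h.iterate_eq⟩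
    · exact Or.inr (exists_top (hS.sup_mem y) (hS.anc_of_supDist_le h hd))
  · rintro (⟨k, -, rfl⟩ | ⟨s, hs, h⟩)
    · exact F.anc_iterate _ _
    · exact hs.1.2.trans (h.trans (hS.anc_sup y))

/-- The nodes between `v` and the skeleton below it. -/
theorem near_iff {v x : V} (hv : ¬ S v) :
    (F.Anc v x ∧ F.depth x - F.depth v ≤ hS.supDist x) ↔
      F.Anc v x ∧ ¬ ∃ s, F.Top S v s ∧ F.Anc s x := by
  refine and_congr_right fun h => ?_
  constructor
  · rintro hd ⟨s, hs, hsx⟩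
    have h1 := hS.supDist_le (v := x) (i := F.depth x - F.depth s)
      (by rw [hsx.iterate_eq]; exact hs.1.1)
    have h2 := hs.1.2.depth_le
    have h3 : F.depth s ≠ F.depth v := fun e =>
      hv (by rw [hs.1.2.eq_of_depth_le e.le]; exact hs.1.1)
    have h4 := hsx.depth_le
    omega
  · intro hn
    by_contra hd
    obtain ⟨s, hs, hsx⟩ := exists_top (hS.sup_mem x) (hS.anc_of_supDist_le h (by omega))
    exact hn ⟨s, hs, hsx.trans (hS.anc_sup x)⟩

/-- The ancestors in the skeleton are found by following its parent pointers. -/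
theorem anc_iff_reflTransGen {t x : V} (ht : S t) : F.Anc t x ↔
    Relation.ReflTransGen (fun a b => S a ∧ b = hS.sup (F.par a)) (hS.sup x) t := by
  constructor
  · intro h
    induction hn : F.depth x - F.depth t using Nat.strong_induction_on generalizing x with
    | _ n ih =>
    have h1 := hS.supDist_le (v := x) (i := F.depth x - F.depth t)
      (by rw [h.iterate_eq]; exact ht)
    have h2 := hS.anc_of_supDist_le h h1
    -- If `t` is a proper ancestor of `sup x`, one skeleton pointer is followed and the induction
    -- continues from the parent of `sup x`.
    by_cases he : t = hS.sup x
    · rw [he]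
    have h3 : F.Anc t (F.par (hS.sup x)) := (F.anc_iff_eq_or_par.1 h2).resolve_left he
    refine Relation.ReflTransGen.head ⟨hS.sup_mem x, rfl⟩ (ih _ ?_ h3 rfl)
    rw [F.depth_par, hS.depth_sup]
    have h4 := h2.depth_le
    have h5 : F.depth t ≠ F.depth (hS.sup x) := fun e => he (h2.eq_of_depth_le e.ge)
    rw [hS.depth_sup] at h4 h5
    omega
  · intro h
    have key : ∀ a b, Relation.ReflTransGen (fun a b => S a ∧ b = hS.sup (F.par a)) a b →
        F.Anc b a := by
      intro a b hab
      induction hab with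
      | refl => exact F.anc_refl _
      | tail _ hbc ih =>
        rw [hbc.2]
        exact ((hS.anc_sup _).trans ⟨1, rfl⟩).trans ih
    exact (key _ _ h).trans (hS.anc_sup x)

end IsSkeleton

end ParentMap

/-! ### Cuts -/

section Cuts

variable {V : Type} [Fintype V]

/-- The total weight from a node to a set. -/
def weightTo (W : V → V → ℕ) (x : V) (X : V → Prop) : ℕ := ∑ y, if X y then W x y else 0

/-- The total weight of the pairs that leave a set. -/
def cutWeight (W : V → V → ℕ) (X : V → Prop) : ℕ :=
  ∑ x, if X x then weightTo W x (fun y => ¬ X y) else 0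

/-- Both cuts contain the weight from `B` to the complement of `X`. The cut of `X` has in addition
what leaves `X` from `X ∖ B`, and the cut of `B` what goes from `B` to `X ∖ B`; the latter can be
counted from the other side by symmetry. The additive form avoids truncated subtraction. -/
theorem cutWeight_add {W : V → V → ℕ} (hW : ∀ x y, W x y = W y x) {X B : V → Prop}
    (hB : ∀ x, B x → X x) :
    cutWeight W X + ∑ x, (if X x ∧ ¬ B x then weightTo W x B else 0) =
      cutWeight W B + ∑ x, if X x ∧ ¬ B x then weightTo W x (fun y => ¬ X y) else 0 := by
  have h : ∑ x, (if X x ∧ ¬ B x then weightTo W x B else 0) =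
      ∑ x, if B x then weightTo W x (fun y => X y ∧ ¬ B y) else 0 := by
    have e1 : ∀ x, (if X x ∧ ¬ B x then weightTo W x B else 0) =
        ∑ y, if (X x ∧ ¬ B x) ∧ B y then W x y else 0 := by
      intro x
      by_cases hx : X x ∧ ¬ B x <;> simp [hx, weightTo]
    have e2 : ∀ x, (if B x then weightTo W x (fun y => X y ∧ ¬ B y) else 0) =
        ∑ y, if B x ∧ (X y ∧ ¬ B y) then W x y else 0 := by
      intro x
      by_cases hx : B x
      · rw [if_pos hx]
        refine Finset.sum_congr rfl fun y _ => ?_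
        by_cases hy : X y ∧ ¬ B y <;> simp only [hx, hy, true_and, if_false]
      · simp [hx]
    simp only [e1, e2]
    rw [Finset.sum_comm]
    refine Finset.sum_congr rfl fun y _ => Finset.sum_congr rfl fun x _ => ?_
    rw [hW x y]
    exact if_congr and_comm rfl rfl
  rw [h, cutWeight, cutWeight, ← Finset.sum_add_distrib, ← Finset.sum_add_distrib]
  refine Finset.sum_congr rfl fun x _ => ?_
  by_cases hx : B x
  · simp only [hx, hB x hx, if_true, not_true, and_false, if_false, weightTo,
      ← Finset.sum_add_distrib, Nat.add_zero]
    refine Finset.sum_congr rfl fun y _ => ?_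
    by_cases hy : B y
    · simp [hy, hB y hy]
    · by_cases hXy : X y <;> simp [hy, hXy]
  · simp [hx]

end Cuts

/-! ### The parent map of a rooted spanning tree -/

namespace RootedSpanningTree

variable {V : Type} {G : SimpleGraph V} (T : RootedSpanningTree G)

/-- The path from the root. -/
def path (v : V) : T.tree.Walk T.root v := (T.isTree.existsUnique_path T.root v).choose

theorem isPath_path (v : V) : (T.path v).IsPath :=
  (T.isTree.existsUnique_path T.root v).choose_spec.1

variable {T}

theorem eq_path {v : V} {p : T.tree.Walk T.root v} (hp : p.IsPath) : p = T.path v :=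
  (T.isTree.existsUnique_path T.root v).unique hp (T.isPath_path v)

theorem mem_desc_iff {u v : V} : u ∈ T.desc v ↔ v ∈ (T.path u).support := by
  constructor
  · rintro ⟨p, hp, h⟩
    rwa [← eq_path hp]
  · exact fun h => ⟨_, T.isPath_path u, h⟩

theorem path_root : T.path T.root = .nil := (eq_path (by simp)).symm

theorem not_nil {v : V} (h : v ≠ T.root) : ¬ (T.path v).Nil := fun hn => h hn.eq.symm

theorem support_path {v : V} (h : v ≠ T.root) :
    (T.path v).support = (T.path (T.path v).penultimate).support ++ [v] := by
  rw [← SimpleGraph.Walk.support_dropLast_concat (not_nil h)]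
  congr 2
  refine eq_path ?_
  exact SimpleGraph.Walk.IsPath.take (T.isPath_path v) _

variable (T)

/-- The parent map of a rooted spanning tree. -/
def parentMap : ParentMap V where
  par v := (T.path v).penultimate
  root := T.root
  par_root := by rw [path_root]; rfl
  reach v := by
    induction hn : (T.path v).support.length using Nat.strong_induction_on generalizing v with
    | _ n ih =>
    by_cases h : v = T.root
    · exact ⟨0, h⟩
    · have := congrArg List.length (support_path h)
      rw [List.length_append, List.length_singleton] at this
      obtain ⟨i, hi⟩ := ih _ (by omega) (T.path v).penultimate rfl
      exact ⟨i + 1, hi⟩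

/-- Induction on the length of the root path, which for `u` other than the root is the path to its
parent followed by `u`. -/
theorem anc_parentMap_iff {u v : V} : T.parentMap.Anc v u ↔ u ∈ T.desc v := by
  rw [mem_desc_iff]
  induction hn : (T.path u).support.length using Nat.strong_induction_on generalizing u with
  | _ n ih =>
  by_cases h : u = T.root
  · subst h
    rw [path_root, SimpleGraph.Walk.support_nil, List.mem_singleton]
    constructor
    · rintro ⟨i, hi⟩
      rw [← hi]
      exact T.parentMap.iterate_root i
    · rintro rfl
      exact T.parentMap.anc_refl _
  · have := congrArg List.length (support_path h)
    rw [List.length_append, List.length_singleton] at this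
    rw [T.parentMap.anc_iff_eq_or_par, support_path h, List.mem_append, List.mem_singleton,
      or_comm]
    exact or_congr_left (ih (T.path (T.path u).penultimate).support.length (by omega) rfl)

theorem isParent_iff {u v : V} : T.IsParent u v ↔ T.parentMap.Child u v := by
  have hroot : T.parentMap.root = T.root := rfl
  constructor
  · rintro ⟨ha, hd⟩
    rw [mem_desc_iff] at hd
    refine ⟨?_, ?_⟩
    · intro h
      rw [hroot] at h
      subst h
      rw [path_root, SimpleGraph.Walk.support_nil, List.mem_singleton] at hd
      exact ha.ne hd
    · exact (T.isTree.isAcyclic.eq_penultimate_of_adj_end (T.isPath_path v) ha.symm hd).symm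
  · rintro ⟨h, rfl⟩
    refine ⟨SimpleGraph.Walk.adj_penultimate (not_nil h), ?_⟩
    rw [← anc_parentMap_iff]
    exact ⟨1, rfl⟩

end RootedSpanningTree

/-! ### Distances -/

namespace SimpleGraph.Connected

variable {V : Type} {G : SimpleGraph V} (hG : G.Connected)
include hG

theorem exists_adj_dist_eq {v u : V} {t : ℕ} (h : G.dist v u = t + 1) :
    ∃ y, G.Adj v y ∧ G.dist y u = t := by
  obtain ⟨p, hp⟩ := hG.exists_walk_length_eq_dist v u
  cases p with
  | nil => simp at h
  | cons ha q =>
    refine ⟨_, ha, ?_⟩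
    have h1 := G.dist_le q
    have h2 := hG.dist_triangle (u := v) (v := ‹_›) (w := u)
    rw [dist_eq_one_iff_adj.2 ha] at h2
    rw [Walk.length_cons] at hp
    omega

theorem dist_le_succ_iff {v u : V} {t : ℕ} :
    G.dist v u ≤ t + 1 ↔ G.dist v u ≤ t ∨ ∃ y, G.Adj v y ∧ G.dist y u ≤ t := by
  constructor
  · intro h
    rcases Nat.lt_or_ge (G.dist v u) (t + 1) with h' | h'
    · exact Or.inl (by omega)
    · obtain ⟨y, hy, hd⟩ := hG.exists_adj_dist_eq (le_antisymm h h')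
      exact Or.inr ⟨y, hy, hd.le⟩
  · rintro (h | ⟨y, hy, h⟩)
    · omega
    · have := hG.dist_triangle (u := v) (v := y) (w := u)
      rw [dist_eq_one_iff_adj.2 hy] at this
      omega

theorem exists_dist_eq {v u : V} {t : ℕ} (h : t ≤ G.dist v u) : ∃ w, G.dist w u = t := by
  induction hn : G.dist v u - t generalizing v with
  | zero => exact ⟨v, by omega⟩
  | succ n ih =>
    obtain ⟨y, _, hd⟩ := hG.exists_adj_dist_eq (t := G.dist v u - 1) (v := v) (u := u) (by omega)
    exact ih (v := y) (by omega) (by omega)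

end SimpleGraph.Connected

/-! ### Gossip -/

section Gossip

/-- The code of the next item that a node sends: the least item that is known and was not yet
sent, plus one, or zero if there is none. -/
def nextItem (s : Finset ℕ × Finset ℕ) : ℕ :=
  if h : (s.1 \ s.2).Nonempty then (s.1 \ s.2).min' h + 1 else 0

/-- The item with a given code. -/
def decodeItem (c : ℕ) : Finset ℕ := if c = 0 then ∅ else {c - 1}

theorem decode_nextItem_subset (s : Finset ℕ × Finset ℕ) : decodeItem (nextItem s) ⊆ s.1 \ s.2 := by
  unfold nextItem decodeItem
  by_cases h : (s.1 \ s.2).Nonempty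
  · simpa [h] using Finset.min'_mem _ h
  · simp [h]

theorem sent_eq_or_card (s : Finset ℕ × Finset ℕ) :
    s.1 ⊆ s.2 ∨ (s.2 ∪ decodeItem (nextItem s)).card = s.2.card + 1 := by
  by_cases h : (s.1 \ s.2).Nonempty
  · right
    rw [Finset.card_union_of_disjoint]
    · simp [nextItem, decodeItem, h]
    · exact Finset.disjoint_of_subset_right (decode_nextItem_subset s) Finset.disjoint_sdiff
  · left
    rwa [Finset.not_nonempty_iff_eq_empty, Finset.sdiff_eq_empty_iff_subset] at h

variable {V : Type} [Fintype V] (G : SimpleGraph V) (own : V → Finset ℕ)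

/-- The items that every node knows and those that it has sent after `t` rounds of gossip. -/
def gossip : ℕ → V → Finset ℕ × Finset ℕ
  | 0, v => (own v, ∅)
  | t + 1, v =>
    ((gossip t v).1 ∪ (Finset.univ.filter (G.Adj v)).biUnion fun y =>
        decodeItem (nextItem (gossip t y)),
      (gossip t v).2 ∪ decodeItem (nextItem (gossip t v)))

theorem gossip_sent_subset (t : ℕ) (v : V) : (gossip G own t v).2 ⊆ (gossip G own t v).1 := by
  induction t with
  | zero => simp [gossip]
  | succ t ih =>
    refine Finset.union_subset (ih.trans Finset.subset_union_left) ?_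
    exact ((decode_nextItem_subset _).trans Finset.sdiff_subset).trans Finset.subset_union_left

theorem gossip_known_subset (t : ℕ) (v : V) :
    (gossip G own t v).1 ⊆ Finset.univ.biUnion own := by
  induction t generalizing v with
  | zero => exact Finset.subset_biUnion_of_mem own (Finset.mem_univ v)
  | succ t ih =>
    refine Finset.union_subset (ih v) (Finset.biUnion_subset.2 fun y _ => ?_)
    exact ((decode_nextItem_subset _).trans Finset.sdiff_subset).trans (ih y)

theorem gossip_adj {u v : V} (h : G.Adj v u) (t : ℕ) :
    (gossip G own t u).2 ⊆ (gossip G own t v).1 := by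
  induction t with
  | zero => simp [gossip]
  | succ t ih =>
    refine Finset.union_subset (ih.trans Finset.subset_union_left) ?_
    exact (Finset.subset_biUnion_of_mem (fun y => decodeItem (nextItem (gossip G own t y)))
      (by simpa using h)).trans Finset.subset_union_right

theorem gossip_own (t : ℕ) (v : V) : own v ⊆ (gossip G own t v).1 := by
  induction t with
  | zero => simp [gossip]
  | succ t ih => exact ih.trans Finset.subset_union_left

/-- The pipelining invariant. A node that sends a new item increases its count. A node with nothing
left has sent all it knows, in particular all that its neighbours have sent, so the claim for the
neighbours with distance smaller by one carries over. -/
theorem gossip_progress (hG : G.Connected) (t d : ℕ) (hd : d ≤ t) (u : V) :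
    t - d ≤ (gossip G own t u).2.card ∨
      ∀ w, G.dist u w ≤ d → own w ⊆ (gossip G own t u).2 := by
  induction t generalizing d u with
  | zero => exact Or.inl (by omega)
  | succ t ih =>
    rcases sent_eq_or_card (gossip G own t u) with h | h
    · have hsub : (gossip G own t u).1 ⊆ (gossip G own (t + 1) u).2 :=
        h.trans Finset.subset_union_left
      cases d with
      | zero =>
        right
        intro w hw
        rw [Nat.le_zero, hG.dist_eq_zero_iff] at hw
        exact hw ▸ (gossip_own G own t u).trans hsub
      | succ d =>
        by_cases hall : ∀ y, G.Adj u y → ∀ w, G.dist y w ≤ d → own w ⊆ (gossip G own t y).2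
        · right
          intro w hw
          by_cases huw : u = w
          · exact huw ▸ (gossip_own G own t u).trans hsub
          obtain ⟨e, he⟩ : ∃ e, G.dist u w = e + 1 :=
            ⟨G.dist u w - 1, by have := hG.pos_dist_of_ne huw; omega⟩
          obtain ⟨y, hy, hyw⟩ := hG.exists_adj_dist_eq he
          exact ((hall y hy w (by omega)).trans (gossip_adj G own hy t)).trans hsub
        · left
          push Not at hall
          obtain ⟨y, hy, w, hw, hn⟩ := hall
          have := (ih d (by omega) y).resolve_right fun hc => hn (hc w hw)
          have := Finset.card_le_card ((gossip_adj G own hy t).trans hsub)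
          omega
    · by_cases hdt : d = t + 1
      · exact Or.inl (by omega)
      rcases ih d (by omega) u with h' | h'
      · left
        rw [show (gossip G own (t + 1) u).2.card = _ from h]
        omega
      · exact Or.inr fun w hw => (h' w hw).trans Finset.subset_union_left

variable {G own}

/-- After `D + K + 1` rounds a node has sent more than `K` items or has sent all items. Comparing
its own count with `K` is therefore a test on which all nodes agree. -/
theorem gossip_complete (hG : G.Connected) {D K : ℕ} (hD : ∀ u w, G.dist u w ≤ D) (u : V) :
    ((gossip G own (D + K + 1) u).2.card ≤ K ↔ (Finset.univ.biUnion own).card ≤ K) ∧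
      ((Finset.univ.biUnion own).card ≤ K →
        (gossip G own (D + K + 1) u).2 = Finset.univ.biUnion own) := by
  have h1 := (gossip_sent_subset G own (D + K + 1) u).trans (gossip_known_subset G own _ u)
  have h2 := Finset.card_le_card h1
  rcases gossip_progress G own hG (D + K + 1) D (by omega) u with h | h
  · constructor
    · omega
    · omega
  · have h3 : (gossip G own (D + K + 1) u).2 = Finset.univ.biUnion own :=
      h1.antisymm (Finset.biUnion_subset.2 fun w _ => h w (hD u w))
    simp [h3]

end Gossip

/-! ### Distributed primitives -/

namespace RootedNetwork

variable (I : RootedNetwork)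

/-- The parent map of the spanning tree. -/
def tree : ParentMap I.V := I.T.parentMap

theorem child_adj {x y : I.V} (h : I.tree.Child x y) : I.N.graph.Adj x y :=
  I.T.le (I.T.isParent_iff.2 h).1

theorem range_sup_ports {v : I.V} (f : I.V → ℕ) :
    (Finset.range (I.N.deg v)).sup (fun i => f (I.nb v i)) =
      Finset.univ.sup fun y => if I.N.graph.Adj v y then f y else 0 := by
  apply le_antisymm
  · refine Finset.sup_le fun i hi => ?_
    refine le_trans ?_ (Finset.le_sup (Finset.mem_univ (I.nb v i)))
    rw [if_pos (I.adj_nb (Finset.mem_range.1 hi))]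
  · refine Finset.sup_le fun y _ => ?_
    split_ifs with h
    · obtain ⟨i, hi, rfl⟩ := I.exists_nb h
      exact Finset.le_sup (f := fun i => f (I.nb v i)) (Finset.mem_range.2 hi)
    · exact Nat.zero_le _

variable {I} in
theorem received_of_lt {β : Type} [Inhabited β] {m : I.V → β} {v : I.V} {i : ℕ}
    (h : i < I.N.deg v) : I.received m v i = m (I.nb v i) := if_pos h

end RootedNetwork

namespace Computes

variable {κ : Type} {P : RootedNetwork → Prop} {C : NodeField κ}

/-- The flooding of a maximum. -/
theorem flood_max (dg : κ → ℕ) (hdg : ∀ I, P I → ∀ v, dg (C I v) = I.N.deg v) (q : NodeField ℕ)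
    (n : ℕ) {m : ℕ} (hq : ∀ I, P I → ∀ v, q I v < 2 ^ m) :
    Computes P (n * m) (fun I v => (C I v, q I v)) fun I v =>
      (C I v, Finset.univ.sup fun u => if I.N.graph.dist v u ≤ n then q I u else 0) := by
  refine (loop (P := P) (Y := fun t I v =>
      (C I v, Finset.univ.sup fun u => if I.N.graph.dist v u ≤ t then q I u else 0)) n
    (fun _ s => s.2)
    (fun _ s x => (s.1, max s.2 ((Finset.range (dg s.1)).sup x))) ?_ ?_).comap id ?_
  · intro t _ I hI v
    rw [Finset.sup_lt_iff (Nat.two_pow_pos m)]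
    intro u _
    split_ifs
    · exact hq I hI u
    · exact Nat.two_pow_pos m
  · intro t _ I hI v
    refine Prod.ext rfl ?_
    dsimp only
    rw [hdg I hI]
    have hx : (Finset.range (I.N.deg v)).sup (I.received (fun u => Finset.univ.sup fun w =>
        if I.N.graph.dist u w ≤ t then q I w else 0) v) = Finset.univ.sup fun y =>
        if I.N.graph.Adj v y then Finset.univ.sup fun w =>
        if I.N.graph.dist y w ≤ t then q I w else 0 else 0 := by
      rw [← I.range_sup_ports fun u => Finset.univ.sup fun w =>
        if I.N.graph.dist u w ≤ t then q I w else 0]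
      exact Finset.sup_congr rfl fun i hi => received_of_lt (Finset.mem_range.1 hi)
    rw [hx]
    apply le_antisymm
    · refine Finset.sup_le fun u _ => ?_
      split_ifs with h
      · rcases I.N.connected.dist_le_succ_iff.1 h with h | ⟨y, hy, h⟩
        · refine le_max_of_le_left (le_trans ?_ (Finset.le_sup (Finset.mem_univ u)))
          rw [if_pos h]
        · refine le_max_of_le_right (le_trans ?_ (Finset.le_sup (Finset.mem_univ y)))
          rw [if_pos hy]
          refine le_trans ?_ (Finset.le_sup (Finset.mem_univ u))
          rw [if_pos h]
      · exact Nat.zero_le _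
    · have key : ∀ u, I.N.graph.dist v u ≤ t + 1 → q I u ≤ Finset.univ.sup fun u =>
          if I.N.graph.dist v u ≤ t + 1 then q I u else 0 := by
        intro u hu
        refine le_trans ?_ (Finset.le_sup (Finset.mem_univ u))
        rw [if_pos hu]
      refine max_le (Finset.sup_le fun u _ => ?_) (Finset.sup_le fun y _ => ?_)
      · split_ifs with h
        · exact key u (by omega)
        · exact Nat.zero_le _
      · split_ifs with hy
        · refine Finset.sup_le fun u _ => ?_
          split_ifs with h
          · exact key u (I.N.connected.dist_le_succ_iff.2 (Or.inr ⟨y, hy, h⟩))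
          · exact Nat.zero_le _
        · exact Nat.zero_le _
  · intro I _ v
    refine Prod.ext rfl ?_
    simp only [Nat.le_zero, I.N.connected.dist_eq_zero_iff]
    apply le_antisymm
    · refine Finset.sup_le fun u _ => ?_
      split_ifs with h
      · rw [h]; rfl
      · exact Nat.zero_le _
    · refine le_trans ?_ (Finset.le_sup (Finset.mem_univ v))
      simp

/-- Flooding along some of the ports. -/
theorem flood (acc : κ → ℕ → Prop) (R : ∀ I : RootedNetwork, I.V → I.V → Prop)
    (hacc : ∀ I, P I → ∀ v i, acc (C I v) i ↔ i < I.N.deg v ∧ R I v (I.nb v i))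
    (hR : ∀ I, P I → ∀ v y, R I v y → I.N.graph.Adj v y) (X : ℕ → NodeField Prop) (n : ℕ) {m : ℕ}
    (hm : 0 < m) (hX : ∀ t < n, ∀ I, P I → ∀ v,
      X (t + 1) I v ↔ X t I v ∨ ∃ y, R I v y ∧ X t I y) :
    Computes P (n * m) (fun I v => (C I v, X 0 I v)) fun I v => (C I v, X n I v) := by
  refine loop (P := P) (Y := fun t I v => (C I v, X t I v)) n
    (fun _ s => if s.2 then 1 else 0)
    (fun _ s x => (s.1, s.2 ∨ ∃ i, acc s.1 i ∧ x i ≠ 0)) ?_ ?_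
  · intro t _ I _ v
    have := Nat.one_lt_two_pow hm.ne'
    split_ifs <;> omega
  · intro t ht I hI v
    refine Prod.ext rfl (propext ?_)
    rw [hX t ht I hI]
    refine or_congr_right ?_
    simp only [hacc I hI]
    constructor
    · rintro ⟨y, hy, hX⟩
      obtain ⟨i, hi, rfl⟩ := I.exists_nb (hR I hI _ _ hy)
      exact ⟨i, ⟨hi, hy⟩, by simp [received, hi, hX]⟩
    · rintro ⟨i, ⟨hi, hy⟩, hx⟩
      refine ⟨_, hy, ?_⟩
      by_contra hX
      exact hx (by simp [received, hi, hX])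

/-- The stream of the items of the ancestors. -/
theorem stream (pp : κ → ℕ → Prop)
    (hpp : ∀ I, P I → ∀ v i, pp (C I v) i ↔ i < I.N.deg v ∧ I.tree.Child (I.nb v i) v)
    (item : NodeField ℕ) (it : κ → ℕ) (hit : ∀ I, P I → ∀ v, item I v = it (C I v)) (n : ℕ)
    {m : ℕ} (hm : ∀ I, P I → ∀ v, item I v < 2 ^ m) :
    Computes P (n * m) C fun I v => (C I v, fun k => if k < n
      then (item I (I.tree.par^[k] v), I.received (fun u => item I (I.tree.par^[k] u)) v)
      else (0, fun _ => 0)) := by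
  refine ((loop (P := P) (Y := fun t I v => ((C I v, item I (I.tree.par^[t] v)), fun k => if k < t
      then (item I (I.tree.par^[k] v), I.received (fun u => item I (I.tree.par^[k] u)) v)
      else (0, fun _ => 0))) n (fun _ s => s.1.2)
    -- The next ancestor's item is what the parent has just sent. The root has no parent port and
    -- repeats its item, in accordance with `par root = root`. All other received items are stored
    -- too: they describe the ancestors of the neighbours.
    (fun t s x => ((s.1.1, if h : ∃ i, pp s.1.1 i then x h.choose else s.1.2),
      fun k => if k = t then (s.1.2, x) else s.2 k)) (fun t _ I hI v => hm I hI _) ?_).comap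
        (fun c => ((c, it c), fun _ => (0, fun _ => 0))) ?_).map (fun s => (s.1.1, s.2)) ?_
  · intro t _ I hI v
    refine Prod.ext (Prod.ext rfl ?_) (funext fun k => ?_)
    · dsimp only
      split_ifs with h
      · have hc := (hpp I hI v _).1 h.choose_spec
        rw [received_of_lt hc.1, ← hc.2.2, Function.iterate_succ_apply]
      · have hr : v = I.tree.root := by
          by_contra hr
          obtain ⟨i, hi, he⟩ := I.exists_nb (I.child_adj (x := I.tree.par v) ⟨hr, rfl⟩).symm
          exact h ⟨i, (hpp I hI v i).2 ⟨hi, hr, he.symm⟩⟩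
        rw [hr, I.tree.iterate_root, I.tree.iterate_root]
    · dsimp only
      by_cases hk : k = t
      · simp [hk]
      · by_cases hk' : k < t
        · simp [hk, hk', Nat.lt_succ_of_lt hk']
        · simp [hk, hk', show ¬ k < t + 1 by omega]
  · intro I hI v
    refine Prod.ext (Prod.ext rfl ?_) (funext fun k => ?_)
    · exact hit I hI v
    · simp
  · intro I _ v
    rfl

/-- Gossip: `items` are the items that a node has initially. -/
theorem gossip (dg : κ → ℕ) (hdg : ∀ I, P I → ∀ v, dg (C I v) = I.N.deg v)
    (own : NodeField (Finset ℕ)) (items : κ → Finset ℕ)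
    (hown : ∀ I, P I → ∀ v, own I v = items (C I v)) (n : ℕ) {m : ℕ}
    (hm : ∀ I, P I → ∀ v, ∀ x ∈ own I v, x + 1 < 2 ^ m) :
    Computes P (n * m) C fun I v => (C I v, (_root_.gossip I.N.graph (own I) n v).2) := by
  refine ((loop (P := P) (Y := fun t I v => (C I v, _root_.gossip I.N.graph (own I) t v)) n
    (fun _ s => nextItem s.2)
    (fun t s x => (s.1, (s.2.1 ∪ (Finset.range (dg s.1)).biUnion fun i => decodeItem (x i),
      s.2.2 ∪ decodeItem (nextItem s.2)))) ?_ ?_).comap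
        (fun c => (c, (items c, ∅))) ?_).map (fun s => (s.1, s.2.2)) ?_
  · intro t _ I hI v
    unfold nextItem
    dsimp only
    split_ifs with h
    · have h1 := Finset.min'_mem _ h
      have h2 := gossip_known_subset _ _ _ _ (Finset.sdiff_subset h1)
      obtain ⟨w, _, hw⟩ := Finset.mem_biUnion.1 h2
      exact hm I hI w _ hw
    · exact Nat.two_pow_pos m
  · intro t _ I hI v
    refine Prod.ext rfl (Prod.ext ?_ rfl)
    dsimp only
    rw [hdg I hI, _root_.gossip]
    dsimp only
    congr 1
    ext x
    simp only [Finset.mem_biUnion, Finset.mem_filter, Finset.mem_univ, true_and, Finset.mem_range]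
    rw [← I.exists_port_iff]
    exact exists_congr fun i => and_congr_right fun hi => by rw [received_of_lt hi]
  · intro I hI v
    rw [← hown I hI]
    rfl
  · intro I _ v
    rfl

/-- Pipelined sums over the subtrees of a tree. -/
theorem upcast (dg : κ → ℕ) (hdg : ∀ I, P I → ∀ v, dg (C I v) = I.N.deg v)
    (F : ∀ I : RootedNetwork, ParentMap I.V) (ch : κ → ℕ → Prop)
    (hch : ∀ I, P I → ∀ v i, ch (C I v) i ↔ i < I.N.deg v ∧ (F I).Child v (I.nb v i))
    (hF : ∀ I, P I → ∀ v y, (F I).Child v y → I.N.graph.Adj v y)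
    (own : NodeField (ℕ → ℕ)) (ow : κ → ℕ → ℕ) (how : ∀ I, P I → ∀ v, own I v = ow (C I v))
    (n : ℕ) {m B : ℕ} (hB : ∀ I, P I → ∀ v t, own I v t ≤ B)
    (hm : ∀ I, P I → Fintype.card I.V * B < 2 ^ m) :
    Computes P (n * m) C fun I v =>
      (C I v, fun k => if k ≤ n then (F I).upcast (own I) k v else 0) := by
  refine (loop (P := P) (Y := fun t I v => (C I v,
      fun k => if k ≤ t then (F I).upcast (own I) k v else 0)) n
    (fun t s => s.2 t)
    (fun t s x => (s.1, fun k => if k = t + 1 then ow s.1 k + ∑ i ∈ Finset.range (dg s.1),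
      (if ch s.1 i then x i else 0) else s.2 k)) ?_ ?_).comap
        (fun c => (c, fun k => if k = 0 then ow c 0 else 0)) ?_
  · intro t _ I hI v
    simp only [le_refl, if_true]
    exact ((F I).upcast_le (hB I hI) t v).trans_lt (hm I hI)
  · intro t _ I hI v
    refine Prod.ext rfl (funext fun k => ?_)
    dsimp only
    by_cases hk : k = t + 1
    · subst hk
      simp only [le_refl, if_true]
      rw [(F I).upcast_succ, hdg I hI, ← how I hI]
      congr 1
      have h1 : ∀ i ∈ Finset.range (I.N.deg v), (if ch (C I v) i
          then I.received (fun u => (F I).upcast (own I) t u) v i else 0) =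
          (fun y => if (F I).Child v y then (F I).upcast (own I) t y else 0) (I.nb v i) := by
        intro i hi
        rw [Finset.mem_range] at hi
        simp [received, hch I hI, hi]
      rw [Finset.sum_congr rfl h1, I.sum_ports fun y =>
        if (F I).Child v y then (F I).upcast (own I) t y else 0]
      refine Finset.sum_congr rfl fun z _ => ?_
      by_cases hz : (F I).Child v z
      · simp [hz, hF I hI v z hz]
      · simp [hz]
    · by_cases hk' : k ≤ t
      · simp [hk, hk', Nat.le_succ_of_le hk']
      · simp [hk, hk', show ¬ k ≤ t + 1 by omega]
  · intro I hI v
    refine Prod.ext rfl (funext fun k => ?_)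
    dsimp only
    by_cases hk : k = 0
    · subst hk
      simp [(F I).upcast_zero, how I hI]
    · simp [hk]

end Computes

/-! ### Breadth-first search and the choice of the parameters -/

namespace RootedNetwork

variable (I : RootedNetwork)

/-- The hop distance from the root. -/
def hop (v : I.V) : ℕ := I.N.graph.dist v I.T.root

/-- The symmetric weight function. -/
def edgeWeight (x y : I.V) : ℕ := if I.N.graph.Adj x y then I.N.weight s(x, y) else 0

theorem edgeWeight_comm (x y : I.V) : I.edgeWeight x y = I.edgeWeight y x := by
  unfold edgeWeight
  rw [Sym2.eq_swap]
  exact if_congr (I.N.graph.adj_comm x y) rfl rfl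

theorem sum_ports_weight {v : I.V} (X : I.V → Prop) :
    ∑ i ∈ Finset.range (I.N.deg v),
        (if X (I.nb v i) then I.edgeWeight v (I.nb v i) else 0) =
      weightTo I.edgeWeight v X := by
  rw [I.sum_ports fun y => if X y then I.edgeWeight v y else 0]
  refine Finset.sum_congr rfl fun y _ => ?_
  by_cases hy : I.N.graph.Adj v y <;> simp [edgeWeight, hy]

theorem cut_eq (X : Set I.V) : I.N.cut X = cutWeight I.edgeWeight (· ∈ X) := by
  unfold Network.cut cutWeight weightTo edgeWeight
  refine Finset.sum_congr rfl fun x _ => ?_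
  by_cases hx : x ∈ X
  · rw [if_pos hx]
    refine Finset.sum_congr rfl fun y _ => ?_
    by_cases hy : y ∈ X <;> simp [hx, hy]
  · simp [hx]

/-- The cut below a node of the spanning tree. -/
def subtreeCut (v : I.V) : ℕ := cutWeight I.edgeWeight (I.tree.Anc v)

theorem subtreeCut_eq (v : I.V) : I.subtreeCut v = I.N.cut (I.T.desc v) := by
  rw [cut_eq]
  exact congrArg _ (funext fun u => propext I.T.anc_parentMap_iff)

theorem length_links (v : I.V) : (I.input v).links.length = I.N.deg v := List.length_ofFn

theorem links_getD {v : I.V} {i : ℕ} (h : i < I.N.deg v) :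
    (I.input v).links.getD i ⟨0, false⟩ =
      ⟨I.edgeWeight v (I.nb v i), decide (I.tree.Child (I.nb v i) v)⟩ := by
  rw [List.getD_eq_getElem _ _ (by rwa [length_links])]
  simp only [input, CongestAlgorithm.localInput, List.getElem_ofFn, edgeWeight, I.adj_nb h, if_true]
  simp only [nb, h, dif_pos]
  congr 1
  exact decide_eq_decide.2 I.T.isParent_iff

theorem root_iff (v : I.V) : v = I.T.root ↔
    ¬ ∃ i < (I.input v).links.length, ((I.input v).links.getD i ⟨0, false⟩).toParent = true := by
  rw [length_links]
  constructor
  · rintro rfl ⟨i, hi, h⟩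
    rw [I.links_getD hi] at h
    exact (of_decide_eq_true h).1 rfl
  · intro h
    by_contra hv
    obtain ⟨i, hi, he⟩ := I.exists_nb (I.child_adj (x := I.tree.par v) ⟨hv, rfl⟩).symm
    refine h ⟨i, hi, ?_⟩
    rw [I.links_getD hi]
    exact decide_eq_true ⟨hv, he.symm⟩

theorem hop_eq_zero_iff {v : I.V} : I.hop v = 0 ↔ v = I.T.root :=
  I.N.connected.dist_eq_zero_iff

/-- The tree of a breadth-first search. -/
def bfsPar (v : I.V) : I.V :=
  if h : ∃ i, i < I.N.deg v ∧ I.hop (I.nb v i) + 1 = I.hop v then I.nb v (Nat.find h) else v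

theorem bfs_port {v : I.V} (hv : v ≠ I.T.root) :
    ∃ i, i < I.N.deg v ∧ I.hop (I.nb v i) + 1 = I.hop v := by
  have h0 := mt I.hop_eq_zero_iff.1 hv
  obtain ⟨y, hy, hd⟩ := I.N.connected.exists_adj_dist_eq (v := v) (u := I.T.root)
    (t := I.hop v - 1) (show I.hop v = _ by omega)
  obtain ⟨i, hi, rfl⟩ := I.exists_nb hy
  exact ⟨i, hi, by rw [hop, hd]; omega⟩

theorem bfsPar_spec {v : I.V} (hv : v ≠ I.T.root) :
    I.N.graph.Adj v (I.bfsPar v) ∧ I.hop (I.bfsPar v) + 1 = I.hop v := by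
  have h := I.bfs_port hv
  rw [bfsPar, dif_pos h]
  exact ⟨I.adj_nb (Nat.find_spec h).1, (Nat.find_spec h).2⟩

theorem bfsPar_root : I.bfsPar I.T.root = I.T.root := by
  rw [bfsPar, dif_neg]
  rintro ⟨i, _, h⟩
  rw [I.hop_eq_zero_iff.2 rfl] at h
  omega

theorem bfs_iterate (v : I.V) : I.bfsPar^[I.hop v] v = I.T.root := by
  induction hn : I.hop v generalizing v with
  | zero => exact I.hop_eq_zero_iff.1 hn
  | succ n ih =>
    have hv : v ≠ I.T.root := fun h => by
      rw [I.hop_eq_zero_iff.2 h] at hn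
      omega
    have := (I.bfsPar_spec hv).2
    exact ih _ (by omega)

/-- The parent map of a breadth-first search tree. -/
def bfs : ParentMap I.V where
  par := I.bfsPar
  root := I.T.root
  par_root := I.bfsPar_root
  reach v := ⟨_, I.bfs_iterate v⟩

theorem depth_bfs (v : I.V) : I.bfs.depth v = I.hop v := by
  induction hn : I.hop v generalizing v with
  | zero => exact I.bfs.depth_eq_zero_iff.2 (I.hop_eq_zero_iff.1 hn)
  | succ n ih =>
    have hv : v ≠ I.T.root := fun h => by
      rw [I.hop_eq_zero_iff.2 h] at hn
      omega
    have := (I.bfsPar_spec hv).2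
    rw [← I.bfs.depth_par_add_one hv]
    exact congrArg (· + 1) (ih _ (show I.hop (I.bfsPar v) = n by omega))

theorem bfs_child_adj {x y : I.V} (h : I.bfs.Child x y) : I.N.graph.Adj x y := by
  rw [← h.2]
  exact (I.bfsPar_spec h.1).1.symm

/-- An attempt with parameters `L` and `b` is bound to fail because of `v`. -/
def Bad (L b : ℕ) (v : I.V) : Prop :=
  L < I.hop v ∨ 2 ^ b ≤ I.N.uid v ∨ ∃ y, 2 ^ b ≤ I.edgeWeight v y

/-- All nodes are at distance at most `L` from the root, and all input numbers have at most `b`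
bits. -/
def Fits (L b : ℕ) (I : RootedNetwork) : Prop := ∀ v, ¬ I.Bad L b v

/-- Flooding for `2 * L + 1` passes suffices even if the diameter is larger: if some node is farther
than `L` from the root, then `v` itself is, or there is a node at distance exactly `L + 1` from the
root and hence within `2 * L + 1` of `v`. -/
theorem fits_iff_sup (L b : ℕ) (v : I.V) :
    I.Fits L b ↔ (Finset.univ.sup fun u => if I.N.graph.dist v u ≤ 2 * L + 1
      then (if I.Bad L b u then 1 else 0) else 0) = 0 := by
  have h0 : (Finset.univ.sup fun u => if I.N.graph.dist v u ≤ 2 * L + 1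
      then (if I.Bad L b u then 1 else 0) else 0) = 0 ↔
      ∀ u, I.N.graph.dist v u ≤ 2 * L + 1 → ¬ I.Bad L b u := by
    rw [← Nat.le_zero, Finset.sup_le_iff]
    refine ⟨fun h u hu hb => ?_, fun h u _ => ?_⟩
    · have := h u (Finset.mem_univ u)
      simp [hu, hb] at this
    · by_cases hu : I.N.graph.dist v u ≤ 2 * L + 1
      · simp [hu, h u hu]
      · simp [hu]
  rw [h0]
  refine ⟨fun h u _ => h u, fun h => ?_⟩
  have hL : ∀ w, I.hop w ≤ L := by
    by_contra hc
    push Not at hc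
    obtain ⟨w, hw⟩ := hc
    have hv : I.hop v ≤ L := by
      by_contra hv
      exact h v (by simp) (Or.inl (by omega))
    obtain ⟨x, hx⟩ := I.N.connected.exists_dist_eq (v := w) (u := I.T.root) (t := L + 1) hw
    refine h x ?_ (Or.inl (show L < I.N.graph.dist x _ by omega))
    have h1 := I.N.connected.dist_triangle (u := v) (v := I.T.root) (w := x)
    rw [SimpleGraph.dist_comm (u := I.T.root), hx] at h1
    have h2 : I.N.graph.dist v I.T.root ≤ L := hv
    omega
  intro w
  refine h w ?_
  have h1 := I.N.connected.dist_triangle (u := v) (v := I.T.root) (w := w)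
  rw [SimpleGraph.dist_comm (u := I.T.root)] at h1
  have h2 : I.N.graph.dist v I.T.root ≤ L := hL v
  have h3 : I.N.graph.dist w I.T.root ≤ L := hL w
  omega

variable {I} {L b : ℕ}

theorem Fits.hop_le (h : I.Fits L b) (v : I.V) : I.hop v ≤ L := by
  by_contra hc
  exact h v (Or.inl (by omega))

theorem Fits.dist_le (h : I.Fits L b) (u v : I.V) : I.N.graph.dist u v ≤ 2 * L := by
  have h1 := I.N.connected.dist_triangle (u := u) (v := I.T.root) (w := v)
  rw [SimpleGraph.dist_comm (u := I.T.root)] at h1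
  have h2 : I.N.graph.dist u I.T.root ≤ L := h.hop_le u
  have h3 : I.N.graph.dist v I.T.root ≤ L := h.hop_le v
  omega

theorem Fits.uid_lt (h : I.Fits L b) (v : I.V) : I.N.uid v < 2 ^ b := by
  by_contra hc
  exact h v (Or.inr (Or.inl (by omega)))

theorem Fits.weight_lt (h : I.Fits L b) (v y : I.V) : I.edgeWeight v y < 2 ^ b := by
  by_contra hc
  exact h v (Or.inr (Or.inr ⟨y, by omega⟩))

/-- Distinct identifiers below `2 ^ b` bound the number of nodes, which is why the unknown `n` needs
no test of its own. -/
theorem Fits.card_le (h : I.Fits L b) : Fintype.card I.V ≤ 2 ^ b := by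
  rw [← Finset.card_univ, ← Finset.card_range (2 ^ b)]
  exact Finset.card_le_card_of_injOn I.N.uid (fun v _ => by simpa using h.uid_lt v)
    (fun _ _ _ _ h => I.N.uid_injective h)

theorem Fits.weightTo_le (h : I.Fits L b) (v : I.V) (X : I.V → Prop) :
    weightTo I.edgeWeight v X ≤ 2 ^ (2 * b) := by
  calc weightTo I.edgeWeight v X ≤ ∑ _y : I.V, 2 ^ b := Finset.sum_le_sum fun y _ => by
        split_ifs
        · exact (h.weight_lt v y).le
        · exact Nat.zero_le _
    _ = Fintype.card I.V * 2 ^ b := by simp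
    _ ≤ 2 ^ b * 2 ^ b := Nat.mul_le_mul_right _ h.card_le
    _ = 2 ^ (2 * b) := by rw [two_mul, pow_add]

theorem Fits.cutWeight_lt (h : I.Fits L b) (X : I.V → Prop) :
    cutWeight I.edgeWeight X < 2 ^ (3 * b + 1) := by
  have : cutWeight I.edgeWeight X ≤ 2 ^ (3 * b) := by
    calc cutWeight I.edgeWeight X ≤ ∑ _y : I.V, 2 ^ (2 * b) := Finset.sum_le_sum fun y _ => by
          split_ifs
          · exact h.weightTo_le _ _
          · exact Nat.zero_le _
      _ = Fintype.card I.V * 2 ^ (2 * b) := by simp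
      _ ≤ 2 ^ b * 2 ^ (2 * b) := Nat.mul_le_mul_right _ h.card_le
      _ = 2 ^ (3 * b) := by rw [← pow_add]; congr 1; ring
  rw [pow_succ]
  have := Nat.two_pow_pos (3 * b)
  omega

end RootedNetwork

namespace Computes

/-- Breadth-first search up to a given distance. -/
theorem hop (L : ℕ) {m : ℕ} (hm : L + 1 < 2 ^ m) :
    Computes (fun _ => True) (L * m) input
      fun I v => (I.input v, if I.hop v ≤ L then I.hop v + 1 else 0) := by
  refine (loop (P := fun _ => True)
    (Y := fun t I v => (I.input v, if I.hop v ≤ t then I.hop v + 1 else 0)) L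
    (fun _ s => s.2)
    -- The code `0` means "not reached". A node reached in pass `t` has distance `t + 1`, hence code
    -- `t + 2`.
    (fun t s x => (s.1, if s.2 ≠ 0 then s.2 else
      if ∃ i, x i ≠ 0 then t + 2 else 0)) ?_ ?_).comap
      (fun c => (c, if ¬ ∃ i < c.links.length, (c.links.getD i ⟨0, false⟩).toParent = true
        then 1 else 0)) ?_
  · intro t ht I _ v
    dsimp only
    split_ifs <;> omega
  · intro t _ I _ v
    refine Prod.ext rfl ?_
    dsimp only
    by_cases hv : I.hop v ≤ t
    · simp [hv, Nat.le_succ_of_le hv]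
    · have hiff : (∃ i, I.received (fun u => if I.hop u ≤ t then I.hop u + 1 else 0) v i ≠ 0) ↔
          I.hop v ≤ t + 1 := by
        rw [show I.hop v ≤ t + 1 ↔ _ from I.N.connected.dist_le_succ_iff]
        rw [show I.N.graph.dist v I.T.root ≤ t ↔ False from iff_false_intro hv, false_or,
          ← I.exists_port_iff]
        refine exists_congr fun i => ?_
        by_cases hi : i < I.N.deg v
        · by_cases hd : I.N.graph.dist (I.nb v i) I.T.root ≤ t <;>
            simp [received, hi, RootedNetwork.hop, hd]
        · simp [received, hi]
      by_cases hv' : I.hop v ≤ t + 1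
      · simp only [hv, hiff, hv', if_true, if_false, ne_eq, not_true]
        omega
      · simp only [hv, hiff, hv', if_false, ne_eq, not_true]
  · intro I _ v
    refine Prod.ext rfl ?_
    simp only [← I.root_iff, Nat.le_zero, I.hop_eq_zero_iff]
    split_ifs with h
    · rw [I.hop_eq_zero_iff.2 h]
    · rfl

/-- The nodes can find out whether the parameters fit. -/
theorem fits (L b : ℕ) {m : ℕ} (hm : L + 1 < 2 ^ m) :
    Computes (fun _ => True) (L * m + (2 * L + 1) * m) input
      fun I v => ((I.input v, if I.hop v ≤ L then I.hop v + 1 else 0), I.Fits L b) := by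
  have h1 : 1 < 2 ^ m := by omega
  refine ((hop L hm).trans ((flood_max (P := fun _ => True)
    (C := fun I v => (I.input v, if I.hop v ≤ L then I.hop v + 1 else 0))
    (fun c => c.1.links.length) (fun I _ v => I.length_links v)
    (fun I v => if I.Bad L b v then 1 else 0) (2 * L + 1) (m := m) (fun I _ v => ?_)).comap
    (fun c => (c, if c.2 = 0 ∨ 2 ^ b ≤ c.1.uid ∨
      ∃ i < c.1.links.length, 2 ^ b ≤ (c.1.links.getD i ⟨0, false⟩).weight then 1 else 0))
      fun I _ v => ?_)).map (fun s => (s.1, s.2 = 0)) fun I _ v => ?_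
  · split_ifs
    · exact h1
    · exact Nat.two_pow_pos m
  · refine Prod.ext rfl (if_congr (or_congr ?_ (or_congr Iff.rfl ?_)) rfl rfl)
    · change L < I.hop v ↔ (if I.hop v ≤ L then I.hop v + 1 else 0) = 0
      split_ifs with h
      · exact iff_of_false (by omega) not_false
      · exact iff_of_true (by omega) rfl
    · have hw : (∃ y, 2 ^ b ≤ I.edgeWeight v y) ↔
          ∃ y, I.N.graph.Adj v y ∧ 2 ^ b ≤ I.edgeWeight v y := by
        refine exists_congr fun y => ⟨fun h => ⟨?_, h⟩, And.right⟩
        by_contra hy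
        have := Nat.two_pow_pos b
        simp [edgeWeight, hy] at h
      rw [hw, ← I.exists_port_iff]
      refine exists_congr fun i => ?_
      dsimp only
      rw [I.length_links]
      refine and_congr_right fun hi => ?_
      rw [I.links_getD hi]
  · exact Prod.ext rfl (propext (I.fits_iff_sup L b v))

end Computes

/-! ### The skeleton of the spanning tree -/

/-- What a node knows about its links in the spanning tree and in the breadth-first search tree. -/
structure LocalContext where
  uid : ℕ
  deg : ℕ
  hop : ℕ
  weight : ℕ → ℕ
  parent : ℕ → Prop
  child : ℕ → Prop
  bfsChild : ℕ → Prop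

namespace RootedNetwork

variable (I : RootedNetwork)

/-- The context of a node. -/
def context (v : I.V) : LocalContext where
  uid := I.N.uid v
  deg := I.N.deg v
  hop := I.hop v
  weight := I.received (fun y => I.edgeWeight v y) v
  parent i := i < I.N.deg v ∧ I.tree.Child (I.nb v i) v
  child i := i < I.N.deg v ∧ I.tree.Child v (I.nb v i)
  bfsChild i := i < I.N.deg v ∧ I.bfs.Child v (I.nb v i)

/-- The identifier of the parent, plus one, or zero at the root. -/
def parentCode (F : ParentMap I.V) (v : I.V) : ℕ :=
  if v = F.root then 0 else I.N.uid (F.par v) + 1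

/-- Children are recognised by comparing the code announced by a neighbour with one's own
identifier. -/
theorem child_iff_parentCode {F : ParentMap I.V} {v y : I.V} :
    F.Child v y ↔ I.parentCode F y = I.N.uid v + 1 := by
  unfold parentCode ParentMap.Child
  split_ifs with h
  · simp [h]
  · simp [h, I.N.uid_injective.eq_iff]

/-- The nodes of a ruling set of the spanning tree. -/
def Ruling (L b : ℕ) (v : I.V) : Prop := I.tree.Cand I.N.uid (2 * L) b v

/-- The nodes of the skeleton. -/
def Skel (L b : ℕ) (v : I.V) : Prop := I.tree.Closure (I.Ruling L b) v

theorem isSkeleton (L b : ℕ) : I.tree.IsSkeleton (I.Skel L b) := ParentMap.isSkeleton_closure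

/-- The distance to the lowest ancestor in the skeleton. -/
def supDist (L b : ℕ) (v : I.V) : ℕ := (I.isSkeleton L b).supDist v

/-- The lowest ancestor in the skeleton. -/
def sup (L b : ℕ) (v : I.V) : I.V := (I.isSkeleton L b).sup v

theorem ruling_near (L b : ℕ) (v : I.V) :
    ∃ u, I.Ruling L b u ∧ I.tree.Near (2 * L * b) v u := ParentMap.exists_cand_near b v

theorem supDist_le (L b : ℕ) (v : I.V) : I.supDist L b v ≤ 3 * (2 * L * b) + 1 := by
  obtain ⟨i, hi, h⟩ := ParentMap.exists_closure_iterate (I.ruling_near L b) v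
  exact ((I.isSkeleton L b).supDist_le h).trans hi

/-- The identifier of the highest skeleton node below `v`, plus one, or zero if there is none. -/
def topCode (L b : ℕ) (v : I.V) : ℕ :=
  Finset.univ.sup fun s => if I.tree.Top (I.Skel L b) v s then I.N.uid s + 1 else 0

theorem topCode_eq {L b : ℕ} {v s : I.V} (h : I.tree.Top (I.Skel L b) v s) :
    I.topCode L b v = I.N.uid s + 1 := by
  apply le_antisymm
  · refine Finset.sup_le fun u _ => ?_
    split_ifs with hu
    · rw [h.unique (I.isSkeleton L b) hu]
    · omega
  · refine le_trans ?_ (Finset.le_sup (Finset.mem_univ s))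
    rw [if_pos h]

theorem topCode_eq_zero {L b : ℕ} {v : I.V} (h : ¬ ∃ s, I.tree.Top (I.Skel L b) v s) :
    I.topCode L b v = 0 := by
  rw [← Nat.le_zero]
  refine Finset.sup_le fun u _ => ?_
  rw [if_neg fun hu => h ⟨u, hu⟩]

theorem exists_of_topCode {L b : ℕ} {v : I.V} {a : ℕ} (h : I.topCode L b v = a + 1) :
    ∃ s, I.tree.Top (I.Skel L b) v s ∧ I.N.uid s = a := by
  by_cases hex : ∃ t, I.tree.Top (I.Skel L b) v t
  · obtain ⟨t, ht⟩ := hex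
    rw [I.topCode_eq ht] at h
    exact ⟨t, ht, by omega⟩
  · rw [I.topCode_eq_zero hex] at h
    omega

variable {I} in
theorem Fits.topCode_le {L b : ℕ} (h : I.Fits L b) (v : I.V) : I.topCode L b v ≤ 2 ^ b := by
  refine Finset.sup_le fun s _ => ?_
  have := h.uid_lt s
  split_ifs <;> omega

/-- The item of `v` in the stream of ancestors. -/
def item (L b : ℕ) (v : I.V) : ℕ :=
  Nat.pair (I.N.uid v) (Nat.pair (I.topCode L b v) (if I.Skel L b v then 1 else 0))

end RootedNetwork

theorem Nat.pair_lt_two_pow {x y k : ℕ} (hx : x < 2 ^ k) (hy : y < 2 ^ k) :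
    Nat.pair x y < 2 ^ (2 * k) := by
  refine (Nat.pair_lt_max_add_one_sq x y).trans_le ?_
  rw [mul_comm, pow_mul]
  exact Nat.pow_le_pow_left (by omega) 2

/-- What a node knows about the tree around it, apart from the weights. -/
structure SkeletonInfo where
  ctx : LocalContext
  mem : Prop
  top : ℕ
  /-- the identifiers of the ancestors, and of the skeleton nodes below them -/
  up : ℕ → ℕ × ℕ
  supDist : ℕ
  supUid : ℕ
  /-- the identifier of the lowest skeleton node among the ancestors of the parent -/
  next : ℕ
  nbUp : ℕ → ℕ → ℕ
  nbSupDist : ℕ → ℕ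
  nbSupUid : ℕ → ℕ

namespace RootedNetwork

variable (I : RootedNetwork)

/-- The information of a node about the skeleton. -/
def info (L b : ℕ) (v : I.V) : SkeletonInfo where
  ctx := I.context v
  mem := I.Skel L b v
  top := I.topCode L b v
  up k := if k < 3 * (2 * L * b) + 3
    then (I.N.uid (I.tree.par^[k] v), I.topCode L b (I.tree.par^[k] v)) else (0, 0)
  supDist := I.supDist L b v
  supUid := I.N.uid (I.sup L b v)
  next := I.N.uid (I.sup L b (I.tree.par v))
  nbUp i k := if k < 3 * (2 * L * b) + 3
    then I.received (fun u => I.N.uid (I.tree.par^[k] u)) v i else 0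
  nbSupDist := I.received (I.supDist L b) v
  nbSupUid := I.received (fun u => I.N.uid (I.sup L b u)) v

end RootedNetwork

/-- The position of the first skeleton item in a stream. -/
def firstSkel (f : ℕ → ℕ) : ℕ := sInf {k | (f k).unpair.2.unpair.2 = 1}

namespace RootedNetwork

variable (I : RootedNetwork)

theorem firstSkel_eq {L b : ℕ} {v : I.V} {f : ℕ → ℕ}
    (hf : ∀ k ≤ 3 * (2 * L * b) + 1, f k = I.item L b (I.tree.par^[k] v)) :
    firstSkel f = I.supDist L b v ∧ (f (firstSkel f)).unpair.1 = I.N.uid (I.sup L b v) := by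
  have hle := I.supDist_le L b v
  have h1 : firstSkel f = I.supDist L b v := by
    apply le_antisymm
    · refine Nat.sInf_le ?_
      have hm : I.Skel L b (I.tree.par^[I.supDist L b v] v) := (I.isSkeleton L b).sup_mem v
      simp [hf _ hle, item, hm]
    · refine le_csInf ⟨I.supDist L b v, ?_⟩ fun k hk => ?_
      · have hm : I.Skel L b (I.tree.par^[I.supDist L b v] v) := (I.isSkeleton L b).sup_mem v
        simp [hf _ hle, item, hm]
      · by_contra hlt
        have hk' := hf k (by omega)
        rw [Set.mem_ofPred_eq, hk'] at hk
        have hm : I.Skel L b (I.tree.par^[k] v) := by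
          by_contra hm
          simp [item, hm] at hk
        exact hlt ((I.isSkeleton L b).supDist_le hm)
  refine ⟨h1, ?_⟩
  rw [h1, hf _ hle]
  simp only [item, Nat.unpair_pair]
  rfl

end RootedNetwork

/-! ### Distributed construction of the skeleton. -/

namespace Computes

/-- The exchange of a quantity that every node knows. -/
theorem send {κ : Type} {P : RootedNetwork → Prop} {C : NodeField κ} (m : ℕ) (q : NodeField ℕ)
    (a : κ → ℕ) (ha : ∀ I, P I → ∀ v, q I v = a (C I v)) (hm : ∀ I, P I → ∀ v, q I v < 2 ^ m) :
    Computes P m C fun I v => (C I v, I.received (q I) v) := by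
  refine (exchange m a fun I hI v => ha I hI v ▸ hm I hI v).map id fun I hI v => ?_
  rw [show q I = fun v => a (C I v) from funext (ha I hI)]
  rfl

variable {L b m : ℕ}

/-- Four exchanges: identifiers, parents in the spanning tree, hop distances, parents in the search
tree. The order matters, because a parent is named by its identifier, and the search-tree parent is
picked by comparing hop distances. -/
theorem context (hm : 6 * b + 8 ≤ m) (hL : L + 1 < 2 ^ m) :
    Computes (Fits L b) (m + m + m + m)
      (fun I v => (I.input v, if I.hop v ≤ L then I.hop v + 1 else 0)) context := by
  have hpow : 2 ^ b < 2 ^ m := Nat.pow_lt_pow_right (by norm_num) (by omega)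
  have hcode : ∀ (I : RootedNetwork), I.Fits L b → ∀ (F : ParentMap I.V) v,
      I.parentCode F v < 2 ^ m := by
    intro I hI F v
    unfold parentCode
    have := hI.uid_lt (F.par v)
    split_ifs <;> omega
  have h1 := (send (P := Fits L b)
    (C := fun I v => (I.input v, if I.hop v ≤ L then I.hop v + 1 else 0)) m
    (fun I v => I.N.uid v) (fun c => c.1.uid) (fun _ _ _ => rfl)
    (fun I hI v => (hI.uid_lt v).trans hpow))
  have h2 := h1.trans (send m (fun I v => I.parentCode I.tree v)
    (fun c => if h : ∃ i < c.1.1.links.length,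
      (c.1.1.links.getD i ⟨0, false⟩).toParent = true then c.2 h.choose + 1 else 0)
    (fun I hI v => ?_) (fun I hI v => hcode I hI _ v))
  have h3 := h2.trans (send m (fun I v => I.hop v) (fun c => c.1.1.2 - 1) (fun I hI v => ?_)
    (fun I hI v => (hI.hop_le v).trans_lt (by omega)))
  have h4 := h3.trans (send m (fun I v => I.parentCode I.bfs v)
    (fun c => if h : ∃ i, i < c.1.1.1.1.links.length ∧ c.2 i + 1 = c.1.1.1.2 - 1
      then c.1.1.2 (Nat.find h) + 1 else 0)
    (fun I hI v => ?_) (fun I hI v => hcode I hI _ v))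
  · refine h4.map (fun c => ⟨c.1.1.1.1.1.uid, c.1.1.1.1.1.links.length, c.1.1.1.1.2 - 1,
      fun i => (c.1.1.1.1.1.links.getD i ⟨0, false⟩).weight,
      fun i => i < c.1.1.1.1.1.links.length ∧
        (c.1.1.1.1.1.links.getD i ⟨0, false⟩).toParent = true,
      fun i => i < c.1.1.1.1.1.links.length ∧ c.1.1.2 i = c.1.1.1.1.1.uid + 1,
      fun i => i < c.1.1.1.1.1.links.length ∧ c.2 i = c.1.1.1.1.1.uid + 1⟩) fun I hI v => ?_
    simp only [RootedNetwork.context, LocalContext.mk.injEq, I.length_links, true_and]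
    refine ⟨rfl, ?_, ?_, ?_, ?_, ?_⟩
    · rw [if_pos (hI.hop_le v), Nat.add_sub_cancel]
    · funext i
      by_cases hi : i < I.N.deg v
      · rw [I.links_getD hi, received_of_lt hi]
      · rw [List.getD_eq_default _ _ (by rw [I.length_links]; omega), received, if_neg hi]
        rfl
    · funext i
      refine propext (and_congr_right fun hi => ?_)
      rw [I.links_getD hi]
      simp
    · funext i
      refine propext (and_congr_right fun hi => ?_)
      rw [received_of_lt hi, I.child_iff_parentCode]
      rfl
    · funext i
      refine propext (and_congr_right fun hi => ?_)
      rw [received_of_lt hi, I.child_iff_parentCode]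
      rfl
  · dsimp only
    have hiff : ∀ i, (i < (I.input v).links.length ∧ I.received (fun u => I.hop u) v i + 1 =
        (if I.hop v ≤ L then I.hop v + 1 else 0) - 1) ↔
        i < I.N.deg v ∧ I.hop (I.nb v i) + 1 = I.hop v := by
      intro i
      rw [I.length_links, if_pos (hI.hop_le v), Nat.add_sub_cancel]
      exact and_congr_right fun hi => by rw [received_of_lt hi]
    simp only [hiff]
    by_cases hv : v = I.T.root
    · rw [dif_neg, parentCode, if_pos (show v = I.bfs.root from hv)]
      rintro ⟨i, _, h⟩
      rw [I.hop_eq_zero_iff.2 hv] at h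
      omega
    · have hex := I.bfs_port hv
      rw [dif_pos hex, parentCode, if_neg (show ¬ v = I.bfs.root from hv),
        received_of_lt (Nat.find_spec hex).1]
      rw [show I.bfs.par v = _ from dif_pos hex]
  · dsimp only
    rw [if_pos (hI.hop_le v), Nat.add_sub_cancel]
  · dsimp only
    by_cases hv : v = I.T.root
    · rw [dif_neg ((I.root_iff v).1 hv), parentCode, if_pos (show v = I.tree.root from hv)]
    · have hex := not_not.1 (mt (I.root_iff v).2 hv)
      rw [dif_pos hex]
      obtain ⟨hi, hp⟩ := hex.choose_spec
      replace hi := hi.trans_eq (I.length_links v)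
      rw [I.links_getD hi] at hp
      rw [received_of_lt hi]
      exact I.child_iff_parentCode.1 (of_decide_eq_true hp)

/-- The computation of the ruling set. -/
theorem ruling (hm : 0 < m) : Computes (Fits L b) (b * (2 * L * m)) RootedNetwork.context
    fun I v => (I.context v, I.Ruling L b v) := by
  refine ((iterate (P := Fits L b)
    (Y := fun i I v => (I.context v, I.tree.Cand I.N.uid (2 * L) i v)) b fun i _ => ?_).comap
    (fun c => (c, True)) fun I _ v => rfl)
  refine ((flood (P := Fits L b) (C := fun I v => (I.context v, I.tree.Cand I.N.uid (2 * L) i v))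
    (fun c k => c.1.child k ∨ c.1.parent k)
    (fun I v y => I.tree.Child v y ∨ I.tree.Child y v) (fun I _ v k => and_or_left.symm)
    (fun I _ v y h => h.elim I.child_adj fun h => (I.child_adj h).symm)
    (fun t I v => ∃ u, (I.tree.Cand I.N.uid (2 * L) i u ∧ (I.N.uid u).testBit i = false) ∧
      I.tree.Near t v u) (2 * L) hm fun t _ I _ v => ?_).comap
    (fun c => (c, c.2 ∧ c.1.uid.testBit i = false)) fun I _ v => ?_).map
    (fun c => (c.1.1, c.1.2 ∧ (c.1.1.uid.testBit i = true → ¬ c.2))) fun I _ v => rfl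
  · simp only [ParentMap.near_succ_iff, and_or_left, exists_or]
    refine or_congr_right ⟨?_, ?_⟩
    · rintro ⟨u, hu, y, hy, h⟩
      exact ⟨y, hy, u, hu, h⟩
    · rintro ⟨y, hy, u, hu, h⟩
      exact ⟨u, hu, y, hy, h⟩
  · refine Prod.ext rfl (propext ?_)
    simp only [ParentMap.near_zero_iff]
    constructor
    · rintro ⟨u, hu, rfl⟩
      exact hu
    · exact fun h => ⟨v, h, rfl⟩

theorem hit (hm : 0 < m) : Computes (Fits L b) ((2 * (2 * L * b) + 1) * m)
    (fun I v => (I.context v, I.Ruling L b v))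
    fun I v => ((I.context v, I.Ruling L b v), I.tree.Hit (I.Ruling L b) v) := by
  refine ((flood (P := Fits L b) (C := fun I v => (I.context v, I.Ruling L b v))
    (fun c k => c.1.child k) (fun I v y => I.tree.Child v y) (fun I _ v k => Iff.rfl)
    (fun I _ v y => I.child_adj)
    (fun t I v => ∃ u, I.Ruling L b u ∧ I.tree.Anc v u ∧
      I.tree.depth u - I.tree.depth v ≤ t) (2 * (2 * L * b) + 1) hm
    fun t _ I _ v => ?_).comap (fun c => (c, c.2)) fun I _ v => ?_).map id fun I _ v => ?_
  · constructor
    · rintro ⟨u, hu, hvu, hd⟩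
      by_cases he : u = v
      · exact Or.inl ⟨u, hu, hvu, by rw [he]; omega⟩
      · have hc := hvu.exists_child he
        refine Or.inr ⟨_, hc, u, hu, I.tree.anc_iterate _ _, ?_⟩
        rw [hc.depth]
        omega
    · rintro (⟨u, hu, hvu, hd⟩ | ⟨y, hy, u, hu, hyu, hd⟩)
      · exact ⟨u, hu, hvu, by omega⟩
      · refine ⟨u, hu, ParentMap.anc_child hy hyu, ?_⟩
        rw [hy.depth] at hd
        omega
  · refine Prod.ext rfl (propext ⟨?_, fun h => ⟨v, h, I.tree.anc_refl v, by omega⟩⟩)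
    rintro ⟨u, hu, hvu, hd⟩
    rwa [hvu.eq_of_depth_le (by omega)]
  · refine Prod.ext rfl (propext ⟨fun h => h.exists_near (I.ruling_near L b), ?_⟩)
    rintro ⟨u, hu, hvu, _⟩
    exact ⟨u, hu, hvu⟩

theorem skel (hm : 0 < m) : Computes (Fits L b) m
    (fun I v => ((I.context v, I.Ruling L b v), I.tree.Hit (I.Ruling L b) v))
    fun I v => (I.context v, I.Skel L b v) := by
  have h1 := Nat.one_lt_two_pow hm.ne'
  refine (send (P := Fits L b)
    (C := fun I v => ((I.context v, I.Ruling L b v), I.tree.Hit (I.Ruling L b) v)) m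
    (fun I v => if I.tree.Hit (I.Ruling L b) v then 1 else 0) (fun c => if c.2 then 1 else 0)
    (fun _ _ _ => rfl) (fun I _ v => by split_ifs <;> omega)).map
    (fun c => (c.1.1.1, (¬ ∃ i, c.1.1.1.parent i) ∨ c.1.1.2 ∨
      ∃ i k, i ≠ k ∧ (c.1.1.1.child i ∧ c.2 i = 1) ∧ (c.1.1.1.child k ∧ c.2 k = 1)))
    fun I _ v => ?_
  refine Prod.ext rfl (propext (or_congr ?_ (or_congr Iff.rfl ?_)))
  · constructor
    · rintro rfl ⟨i, hi, hc⟩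
      exact hc.1 rfl
    · intro h
      by_contra hv
      obtain ⟨i, hi, he⟩ := I.exists_nb (I.child_adj (x := I.tree.par v) ⟨hv, rfl⟩).symm
      exact h ⟨i, hi, hv, he.symm⟩
  · dsimp only
    constructor
    · rintro ⟨c, c', hne, ⟨hc, hh⟩, hc', hh'⟩
      obtain ⟨i, hi, rfl⟩ := I.exists_nb (I.child_adj hc)
      obtain ⟨k, hk, rfl⟩ := I.exists_nb (I.child_adj hc')
      refine ⟨i, k, fun e => hne (e ▸ rfl), ⟨⟨hi, hc⟩, ?_⟩, ⟨hk, hc'⟩, ?_⟩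
      · rw [received_of_lt hi, if_pos hh]
      · rw [received_of_lt hk, if_pos hh']
    · rintro ⟨i, k, hne, ⟨⟨hi, hc⟩, hh⟩, ⟨hk, hc'⟩, hh'⟩
      rw [received_of_lt hi] at hh
      rw [received_of_lt hk] at hh'
      refine ⟨_, _, fun e => hne (I.nb_inj hi hk e), ⟨hc, ?_⟩, hc', ?_⟩
      · by_contra hn
        simp [hn] at hh
      · by_contra hn
        simp [hn] at hh'

theorem topCode (hm : 6 * b + 8 ≤ m) : Computes (Fits L b) ((2 * (2 * L * b) + 1) * m)
    (fun I v => (I.context v, I.Skel L b v))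
    fun I v => ((I.context v, I.Skel L b v), I.topCode L b v) := by
  have hpow : 2 ^ b < 2 ^ m := Nat.pow_lt_pow_right (by norm_num) (by omega)
  refine ((loop (P := Fits L b) (Y := fun t I v => ((I.context v, I.Skel L b v),
    Finset.univ.sup fun s => if I.tree.Top (I.Skel L b) v s ∧
      I.tree.depth s - I.tree.depth v ≤ t then I.N.uid s + 1 else 0)) (2 * (2 * L * b) + 1)
    (fun _ s => s.2) (fun _ s x => (s.1, if s.1.2 then s.2 else
      (Finset.range s.1.1.deg).sup fun i => if s.1.1.child i then x i else 0))
    (fun t _ I hI v => ?_) fun t _ I _ v => ?_).comap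
    (fun c => (c, if c.2 then c.1.uid + 1 else 0)) fun I _ v => ?_).map id fun I _ v => ?_
  · rw [Finset.sup_lt_iff (Nat.two_pow_pos m)]
    intro u _
    have := hI.uid_lt u
    split_ifs <;> omega
  · refine Prod.ext rfl ?_
    dsimp only
    split_ifs with hS
    · refine Finset.sup_congr rfl fun s _ => if_congr (and_congr_right fun h => ?_) rfl rfl
      rw [h.eq_self hS]
      omega
    · have hx : ((Finset.range (I.N.deg v)).sup fun i => if (I.context v).child i then
          I.received (fun u => Finset.univ.sup fun s => if I.tree.Top (I.Skel L b) u s ∧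
            I.tree.depth s - I.tree.depth u ≤ t then I.N.uid s + 1 else 0) v i else 0) =
          (Finset.range (I.N.deg v)).sup fun i => (fun y => if I.tree.Child v y then
            Finset.univ.sup fun s => if I.tree.Top (I.Skel L b) y s ∧
            I.tree.depth s - I.tree.depth y ≤ t then I.N.uid s + 1 else 0 else 0) (I.nb v i) := by
        refine Finset.sup_congr rfl fun i hi => ?_
        rw [Finset.mem_range] at hi
        simp [RootedNetwork.context, hi, received]
      rw [show (I.context v).deg = I.N.deg v from rfl, hx, I.range_sup_ports fun y =>
        if I.tree.Child v y then
            Finset.univ.sup fun s => if I.tree.Top (I.Skel L b) y s ∧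
            I.tree.depth s - I.tree.depth y ≤ t then I.N.uid s + 1 else 0 else 0]
      apply le_antisymm
      · refine Finset.sup_le fun s _ => ?_
        split_ifs with h
        · obtain ⟨c, hc, hcs⟩ := (ParentMap.top_iff_child hS).1 h.1
          refine le_trans ?_ (Finset.le_sup (Finset.mem_univ c))
          rw [if_pos (I.child_adj hc), if_pos hc]
          refine le_trans ?_ (Finset.le_sup (Finset.mem_univ s))
          rw [if_pos ⟨hcs, by rw [hc.depth]; omega⟩]
        · exact Nat.zero_le _
      · refine Finset.sup_le fun c _ => ?_
        split_ifs with ha hc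
        · refine Finset.sup_le fun s _ => ?_
          split_ifs with h
          · refine le_trans ?_ (Finset.le_sup (Finset.mem_univ s))
            have hd := hc.depth
            rw [if_pos ⟨(ParentMap.top_iff_child hS).2 ⟨c, hc, h.1⟩, by omega⟩]
          · exact Nat.zero_le _
        · exact Nat.zero_le _
        · exact Nat.zero_le _
  · refine Prod.ext rfl ?_
    dsimp only
    have key : ∀ s, (I.tree.Top (I.Skel L b) v s ∧ I.tree.depth s - I.tree.depth v ≤ 0) ↔
        I.Skel L b v ∧ s = v := by
      intro s
      constructor
      · rintro ⟨h, hd⟩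
        have := h.1.2.eq_of_depth_le (by omega)
        subst this
        exact ⟨h.1.1, rfl⟩
      · rintro ⟨h, rfl⟩
        exact ⟨ParentMap.top_self h, by omega⟩
    simp only [key]
    by_cases hS : I.Skel L b v
    · rw [if_pos hS]
      apply le_antisymm
      · refine Finset.sup_le fun s _ => ?_
        split_ifs with h
        · rw [h.2]
          exact le_rfl
        · exact Nat.zero_le _
      · refine le_trans ?_ (Finset.le_sup (Finset.mem_univ v))
        rw [if_pos ⟨hS, rfl⟩]
        exact le_rfl
    · simp [hS]
  · refine Prod.ext rfl ?_
    refine Finset.sup_congr rfl fun s _ => if_congr ?_ rfl rfl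
    exact (and_iff_left_of_imp fun h => h.depth_le_closure (I.ruling_near L b)).symm

theorem info (hm : 6 * b + 8 ≤ m) : Computes (Fits L b) ((3 * (2 * L * b) + 3) * m)
    (fun I v => ((I.context v, I.Skel L b v), I.topCode L b v)) fun I => I.info L b := by
  refine (stream (P := Fits L b)
    (C := fun I v => ((I.context v, I.Skel L b v), I.topCode L b v))
    (fun c => c.1.1.parent) (fun _ _ _ _ => Iff.rfl) (fun I => I.item L b)
    (fun c => Nat.pair c.1.1.uid (Nat.pair c.2 (if c.1.2 then 1 else 0))) (fun _ _ _ => rfl)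
    -- The lowest skeleton node among the ancestors of the parent can be at index `3 * (2 * L * b) +
    -- 2` of the stream of `v`, one more than for `v` itself.
    (3 * (2 * L * b) + 3) (m := m) fun I hI v => ?_).map
    (fun c => ⟨c.1.1.1, c.1.1.2, c.1.2,
      fun k => (((c.2 k).1.unpair).1, (c.2 k).1.unpair.2.unpair.1),
      firstSkel fun k => (c.2 k).1,
      (c.2 (firstSkel fun k => (c.2 k).1)).1.unpair.1,
      (c.2 (firstSkel (fun k => (c.2 (k + 1)).1) + 1)).1.unpair.1,
      fun i k => ((c.2 k).2 i).unpair.1,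
      fun i => if i < c.1.1.1.deg then firstSkel fun k => (c.2 k).2 i else 0,
      fun i => if i < c.1.1.1.deg
        then ((c.2 (firstSkel fun k => (c.2 k).2 i)).2 i).unpair.1 else 0⟩) fun I hI v => ?_
  · have hpow : 2 ^ b < 2 ^ (b + 1) := Nat.pow_lt_pow_right (by norm_num) (by omega)
    have h1 := hI.uid_lt v
    have h2 := hI.topCode_le v
    have h3 : (if I.Skel L b v then 1 else 0) < 2 ^ (b + 1) := by
      have := Nat.one_lt_two_pow (n := b + 1) (by omega)
      split_ifs <;> omega
    have h4 := Nat.pair_lt_two_pow (h2.trans_lt hpow) h3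
    have h5 : 2 ^ b ≤ 2 ^ (2 * (b + 1)) := Nat.pow_le_pow_right (by norm_num) (by omega)
    exact (Nat.pair_lt_two_pow (h1.trans_le h5) h4).trans_le
      (Nat.pow_le_pow_right (by norm_num) (by omega))
  · have e1 := I.firstSkel_eq (L := L) (b := b) (v := v)
      (f := fun k => (if k < 3 * (2 * L * b) + 3 then (I.item L b (I.tree.par^[k] v),
        I.received (fun u => I.item L b (I.tree.par^[k] u)) v) else (0, fun _ => 0)).1)
      (fun k hk => by rw [if_pos (by omega)])
    have e2 := I.firstSkel_eq (L := L) (b := b) (v := I.tree.par v)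
      (f := fun k => (if k + 1 < 3 * (2 * L * b) + 3 then (I.item L b (I.tree.par^[k + 1] v),
        I.received (fun u => I.item L b (I.tree.par^[k + 1] u)) v) else (0, fun _ => 0)).1)
      (fun k hk => by rw [if_pos (by omega), Function.iterate_succ_apply])
    have e3 := fun i (hi : i < I.N.deg v) => I.firstSkel_eq (L := L) (b := b) (v := I.nb v i)
      (f := fun k => (if k < 3 * (2 * L * b) + 3 then (I.item L b (I.tree.par^[k] v),
        I.received (fun u => I.item L b (I.tree.par^[k] u)) v) else (0, fun _ => 0)).2 i)
      (fun k hk => by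
        rw [if_pos (by omega)]
        exact received_of_lt (m := fun u => I.item L b (I.tree.par^[k] u)) hi)
    simp only [RootedNetwork.info, SkeletonInfo.mk.injEq, true_and]
    refine ⟨?_, e1.1.symm, e1.2.symm, e2.2.symm, ?_, ?_, ?_⟩
    · funext k
      split_ifs
      · simp [RootedNetwork.item]
      · simp
    · funext i k
      split_ifs
      · by_cases hi : i < I.N.deg v
        · simp [RootedNetwork.item, received, hi]
        · simp [received, hi]
      · simp
    · funext i
      by_cases hi : i < I.N.deg v
      · rw [received_of_lt hi, if_pos (show i < (I.context v).deg from hi)]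
        exact (e3 i hi).1.symm
      · rw [received, if_neg hi, if_neg (show ¬ i < (I.context v).deg from hi)]
        rfl
    · funext i
      by_cases hi : i < I.N.deg v
      · rw [received_of_lt hi, if_pos (show i < (I.context v).deg from hi)]
        exact (e3 i hi).2.symm
      · rw [received, if_neg hi, if_neg (show ¬ i < (I.context v).deg from hi)]
        rfl

end Computes

/-! ### Cuts below the nodes of the skeleton -/

/-- `t` is reached from `a` along the pairs in a set. -/
def Follows (Z : Finset ℕ) (t a : ℕ) : Prop :=
  Relation.ReflTransGen (fun x y => Nat.pair x y ∈ Z) a t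

/-- The total weight of the ports with a given property. -/
def portSum (c : LocalContext) (Q : ℕ → Prop) : ℕ :=
  ∑ i ∈ Finset.range c.deg, if Q i then c.weight i else 0

namespace RootedNetwork

variable (I : RootedNetwork)

/-- The pairs of identifiers of the edges of the skeleton. -/
def skelItems (L b : ℕ) (v : I.V) : Finset ℕ :=
  if I.Skel L b v then {Nat.pair (I.N.uid v) (I.N.uid (I.sup L b (I.tree.par v)))} else ∅

/-- The skeleton. -/
def skelSet (L b : ℕ) : Finset ℕ := Finset.univ.biUnion (I.skelItems L b)

/-- The skeleton is small. -/
def Small (L b K : ℕ) (I : RootedNetwork) : Prop := (I.skelSet L b).card ≤ K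

variable {I} {L b K : ℕ}

theorem mem_skelSet {x : ℕ} : x ∈ I.skelSet L b ↔
    ∃ s, I.Skel L b s ∧ x = Nat.pair (I.N.uid s) (I.N.uid (I.sup L b (I.tree.par s))) := by
  unfold skelSet skelItems
  rw [Finset.mem_biUnion]
  constructor
  · rintro ⟨s, -, h⟩
    split_ifs at h with hs
    · exact ⟨s, hs, Finset.mem_singleton.1 h⟩
    · simp at h
  · rintro ⟨s, hs, rfl⟩
    exact ⟨s, Finset.mem_univ s, by simp [hs]⟩

theorem skelSet_eq : I.skelSet L b = (Finset.univ.filter (I.Skel L b)).image fun s =>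
    Nat.pair (I.N.uid s) (I.N.uid (I.sup L b (I.tree.par s))) := by
  ext x
  rw [mem_skelSet]
  simp [eq_comm]

theorem card_skelSet : (I.skelSet L b).card = (Finset.univ.filter (I.Skel L b)).card := by
  rw [skelSet_eq, Finset.card_image_of_injective]
  intro s s' h
  exact I.N.uid_injective (Nat.pair_eq_pair.1 h).1

/-- Transfers the search along skeleton pointers to identifiers; injectivity of `uid` excludes
spurious steps. The pointer of the root is a harmless loop. -/
theorem follows_iff {t x : I.V} (ht : I.Skel L b t) :
    Follows (I.skelSet L b) (I.N.uid t) (I.N.uid (I.sup L b x)) ↔ I.tree.Anc t x := by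
  rw [(I.isSkeleton L b).anc_iff_reflTransGen ht]
  constructor
  · intro h
    have key : ∀ c, Relation.ReflTransGen (fun x y => Nat.pair x y ∈ I.skelSet L b)
        (I.N.uid (I.sup L b x)) c → ∃ z, c = I.N.uid z ∧ Relation.ReflTransGen
          (fun a c => I.Skel L b a ∧ c = (I.isSkeleton L b).sup (I.tree.par a))
          ((I.isSkeleton L b).sup x) z := by
      intro c hc
      induction hc with
      | refl => exact ⟨_, rfl, .refl⟩
      | tail _ hcd ih =>
        obtain ⟨z, rfl, hz⟩ := ih
        obtain ⟨s, hs, he⟩ := mem_skelSet.1 hcd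
        obtain ⟨h1, h2⟩ := Nat.pair_eq_pair.1 he
        obtain rfl := I.N.uid_injective h1
        exact ⟨_, h2, hz.tail ⟨hs, rfl⟩⟩
    obtain ⟨z, hz, h'⟩ := key _ h
    exact I.N.uid_injective hz ▸ h'
  · intro h
    refine h.lift I.N.uid fun a c hac => ?_
    exact mem_skelSet.2 ⟨a, hac.1, by rw [hac.2]; rfl⟩

theorem portSum_eq {v : I.V} {Q : ℕ → Prop} {X : I.V → Prop}
    (h : ∀ i < I.N.deg v, (Q i ↔ X (I.nb v i))) :
    portSum (I.context v) Q = weightTo I.edgeWeight v X := by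
  rw [← I.sum_ports_weight]
  refine Finset.sum_congr rfl fun i hi => ?_
  have hi : i < I.N.deg v := Finset.mem_range.1 hi
  simp only [h i hi, context, received_of_lt hi]

theorem Fits.portSum_le (hI : I.Fits L b) {v : I.V} {Q : ℕ → Prop} :
    portSum (I.context v) Q ≤ 2 ^ (2 * b) := by
  refine le_trans ?_ (hI.weightTo_le v fun _ => True)
  rw [← portSum_eq (Q := fun _ => True) (fun _ _ => Iff.rfl)]
  exact Finset.sum_le_sum fun i _ => by by_cases hQ : Q i <;> simp [hQ]

theorem info_nbSupUid {v : I.V} {i : ℕ} (hi : i < I.N.deg v) :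
    (I.info L b v).nbSupUid i = I.N.uid (I.sup L b (I.nb v i)) :=
  received_of_lt (m := fun u => I.N.uid (I.sup L b u)) hi

end RootedNetwork

/-- The identifier of the lower end of the `i`-th edge of the skeleton. -/
def coordinate (Z : Finset ℕ) (i : ℕ) : ℕ := (Z.toList.getD i 0).unpair.1

/-- The contribution of a node to the cut below a skeleton node, at the time when it is due. -/
def skelShare (L : ℕ) (c : SkeletonInfo × Finset ℕ) (t : ℕ) : ℕ :=
  if L ≤ t + c.1.ctx.hop ∧ t + c.1.ctx.hop - L < c.2.card ∧
      Follows c.2 (coordinate c.2 (t + c.1.ctx.hop - L)) c.1.supUid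
  then portSum c.1.ctx fun i =>
    ¬ Follows c.2 (coordinate c.2 (t + c.1.ctx.hop - L)) (c.1.nbSupUid i)
  else 0

namespace RootedNetwork

variable {I : RootedNetwork} {L b K : ℕ}

theorem exists_coordinate {i : ℕ} (h : i < (I.skelSet L b).card) :
    ∃ s, I.Skel L b s ∧ coordinate (I.skelSet L b) i = I.N.uid s := by
  unfold coordinate
  rw [List.getD_eq_getElem _ _ (by rwa [Finset.length_toList])]
  obtain ⟨s, hs, he⟩ := mem_skelSet.1 (Finset.mem_toList.1
    (List.getElem_mem (l := (I.skelSet L b).toList) (by rwa [Finset.length_toList])))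
  exact ⟨s, hs, by rw [he, Nat.unpair_pair]⟩

theorem exists_of_skel {s : I.V} (h : I.Skel L b s) :
    ∃ i < (I.skelSet L b).card, coordinate (I.skelSet L b) i = I.N.uid s := by
  obtain ⟨i, hi, he⟩ := List.getElem_of_mem (Finset.mem_toList.2 (mem_skelSet.2 ⟨s, h, rfl⟩))
  refine ⟨i, by rwa [Finset.length_toList] at hi, ?_⟩
  rw [coordinate, List.getD_eq_getElem _ _ hi, he, Nat.unpair_pair]

theorem skelShare_le (hI : I.Fits L b) (v : I.V) (t : ℕ) :
    skelShare L (I.info L b v, I.skelSet L b) t ≤ 2 ^ (2 * b) := by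
  unfold skelShare
  split_ifs
  · exact hI.portSum_le
  · exact Nat.zero_le _

/-- A node at hop distance `h` injects its share of the `i`-th cut in round `L + i - h`, so all
shares reach the root in round `L + i`. The enumeration in `coordinate` depends on the set alone, so
the nodes agree on it. -/
theorem upcast_skelShare (hI : I.Fits L b) {i : ℕ} {s : I.V} (hs : I.Skel L b s)
    (hi : i < (I.skelSet L b).card) (h : coordinate (I.skelSet L b) i = I.N.uid s) :
    I.bfs.upcast (fun v => skelShare L (I.info L b v, I.skelSet L b)) (L + i) I.T.root =
      I.subtreeCut s := by
  refine Finset.sum_congr rfl fun y _ => ?_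
  have h1 : I.hop I.T.root = 0 := I.hop_eq_zero_iff.2 rfl
  have h2 := hI.hop_le y
  rw [I.depth_bfs, I.depth_bfs, h1, if_pos ⟨I.bfs.anc_root y, by omega⟩]
  have h3 : L + i - (I.hop y - 0) + (I.info L b y).ctx.hop = L + i :=
    show L + i - (I.hop y - 0) + I.hop y = L + i by omega
  unfold skelShare
  dsimp only
  rw [h3, Nat.add_sub_cancel_left, h]
  refine (if_congr ?_ ?_ rfl)
  · rw [show (I.info L b y).supUid = I.N.uid (I.sup L b y) from rfl, follows_iff hs]
    exact ⟨fun h => h.2.2, fun h => ⟨by omega, hi, h⟩⟩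
  · refine portSum_eq fun k hk => ?_
    rw [info_nbSupUid hk, follows_iff hs]

variable (I L b) in
/-- The identifiers of the skeleton nodes together with the cuts below them. -/
def cutSet : Finset ℕ := (Finset.univ.filter (I.Skel L b)).image fun s =>
  Nat.pair (I.N.uid s) (I.subtreeCut s)

end RootedNetwork

/-- The value that a set of pairs assigns to a number. -/
def lookup (Z : Finset ℕ) (a : ℕ) : ℕ := if h : ∃ x, Nat.pair a x ∈ Z then h.choose else 0

theorem RootedNetwork.lookup_cutSet {I : RootedNetwork} {L b : ℕ} {s : I.V} (h : I.Skel L b s) :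
    lookup (I.cutSet L b) (I.N.uid s) = I.subtreeCut s := by
  have hex : ∃ x, Nat.pair (I.N.uid s) x ∈ I.cutSet L b :=
    ⟨_, Finset.mem_image_of_mem _ (Finset.mem_filter.2 ⟨Finset.mem_univ s, h⟩)⟩
  rw [lookup, dif_pos hex]
  obtain ⟨s', _, he⟩ := Finset.mem_image.1 hex.choose_spec
  obtain ⟨h1, h2⟩ := Nat.pair_eq_pair.1 he
  rw [← h2, I.N.uid_injective h1]

/-! ### Cuts below the other nodes -/

/-- The neighbour at port `i` is below the skeleton node that hangs below the `k`-th ancestor. -/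
def Hangs (c : SkeletonInfo × Finset ℕ) (k i : ℕ) : Prop :=
  ∃ a, (c.1.up k).2 = a + 1 ∧ Follows c.2 a (c.1.nbSupUid i)

/-- The neighbour at port `i` is below the `k`-th ancestor. -/
def Below (c : SkeletonInfo × Finset ℕ) (k i : ℕ) : Prop :=
  (∃ k' ≤ c.1.nbSupDist i, c.1.nbUp i k' = (c.1.up k).1) ∨ Hangs c k i

/-- The weight from a node out of the subtree of one of its ancestors. -/
def outShare (E : ℕ) (c : SkeletonInfo × Finset ℕ) (t : ℕ) : ℕ :=
  if t ≤ E ∧ E - t ≤ c.1.supDist then portSum c.1.ctx fun i => ¬ Below c (E - t) i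
  else 0

/-- The weight from a node to the subtree of a skeleton node below one of its ancestors. -/
def hangShare (E : ℕ) (c : SkeletonInfo × Finset ℕ) (t : ℕ) : ℕ :=
  if t ≤ E ∧ E - t ≤ c.1.supDist then portSum c.1.ctx (Hangs c (E - t)) else 0

namespace RootedNetwork

variable {I : RootedNetwork} {L b K : ℕ}

theorem hangs_iff {v : I.V} {k i : ℕ} (hk : k ≤ I.supDist L b v) (hi : i < I.N.deg v) :
    Hangs (I.info L b v, I.skelSet L b) k i ↔
      ∃ s, I.tree.Top (I.Skel L b) (I.tree.par^[k] v) s ∧ I.tree.Anc s (I.nb v i) := by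
  have hE := I.supDist_le L b v
  have h1 : ((I.info L b v).up k).2 = I.topCode L b (I.tree.par^[k] v) := by
    simp only [info]
    rw [if_pos (by omega)]
  have h2 := info_nbSupUid (L := L) (b := b) hi
  unfold Hangs
  dsimp only
  rw [h1, h2]
  constructor
  · rintro ⟨a, ha, hf⟩
    obtain ⟨s, hs, rfl⟩ := I.exists_of_topCode ha
    exact ⟨s, hs, (follows_iff hs.1.1).1 hf⟩
  · rintro ⟨s, hs, h⟩
    exact ⟨_, I.topCode_eq hs, (follows_iff hs.1.1).2 h⟩

/-- This is `IsSkeleton.anc_iff` in terms of identifiers. The bounds on `supDist` keep the entries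
in use inside the recorded range, beyond which the lists contain the default `0`. -/
theorem below_iff {v : I.V} {k i : ℕ} (hk : k ≤ I.supDist L b v) (hi : i < I.N.deg v) :
    Below (I.info L b v, I.skelSet L b) k i ↔ I.tree.Anc (I.tree.par^[k] v) (I.nb v i) := by
  have hE := I.supDist_le L b v
  have hE' := I.supDist_le L b (I.nb v i)
  have h1 : ((I.info L b v).up k).1 = I.N.uid (I.tree.par^[k] v) := by
    simp only [info]
    rw [if_pos (by omega)]
  have h2 : (I.info L b v).nbSupDist i = I.supDist L b (I.nb v i) := received_of_lt hi
  rw [Below, hangs_iff hk hi]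
  dsimp only
  rw [h1, h2]
  constructor
  · rintro (⟨k', hk', he⟩ | ⟨s, hs, h⟩)
    · have h3 : (I.info L b v).nbUp i k' = I.N.uid (I.tree.par^[k'] (I.nb v i)) := by
        simp only [info]
        rw [if_pos (by omega)]
        exact received_of_lt hi
      rw [h3] at he
      exact ⟨k', I.N.uid_injective he⟩
    · exact hs.1.2.trans h
  · intro h
    rcases (I.isSkeleton L b).anc_iff.1 h with ⟨k', hk', he⟩ | ⟨s, hs, h⟩
    · left
      have hk'' : k' ≤ I.supDist L b (I.nb v i) := hk'
      refine ⟨k', hk', ?_⟩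
      simp only [info]
      rw [if_pos (by omega), ← he]
      exact received_of_lt (m := fun u => I.N.uid (I.tree.par^[k'] u)) hi
    · exact Or.inr ⟨s, hs, h.trans ((I.isSkeleton L b).anc_sup _)⟩

theorem outShare_le (hI : I.Fits L b) (E : ℕ) (v : I.V) (t : ℕ) :
    outShare E (I.info L b v, I.skelSet L b) t ≤ 2 ^ (2 * b) := by
  unfold outShare
  split_ifs
  · exact hI.portSum_le
  · exact Nat.zero_le _

theorem hangShare_le (hI : I.Fits L b) (E : ℕ) (v : I.V) (t : ℕ) :
    hangShare E (I.info L b v, I.skelSet L b) t ≤ 2 ^ (2 * b) := by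
  unfold hangShare
  split_ifs
  · exact hI.portSum_le
  · exact Nat.zero_le _

/-- The part of the tree below `v` that hangs at the skeleton node below `v`. -/
def Hanging (L b : ℕ) (v y : I.V) : Prop := ∃ s, I.tree.Top (I.Skel L b) v s ∧ I.tree.Anc s y

/-- With `E = 3 * (2 * L * b) + 1`, a node `d` levels below `v` injects in round `E - d` the share
meant for its `d`-th ancestor; it arrives at `v` in round `E`. Thus every node outside the skeleton
reads off its sum in the same round `E`. By `near_iff`, the condition `d ≤ supDist` selects the part
of the subtree that does not hang at the skeleton. -/
theorem upcast_share (f : I.V → ℕ → ℕ) (g : I.V → I.V → ℕ) {v : I.V} (hv : ¬ I.Skel L b v)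
    (h : ∀ y t, f y t = if t ≤ 3 * (2 * L * b) + 1 ∧ 3 * (2 * L * b) + 1 - t ≤ I.supDist L b y
      then g (I.tree.par^[3 * (2 * L * b) + 1 - t] y) y else 0) :
    I.tree.upcast f (3 * (2 * L * b) + 1) v =
      ∑ y, if I.tree.Anc v y ∧ ¬ Hanging L b v y then g v y else 0 := by
  refine Finset.sum_congr rfl fun y _ => ?_
  have hE := I.supDist_le L b y
  have hiff : (I.tree.Anc v y ∧ I.tree.depth y - I.tree.depth v ≤ I.supDist L b y) ↔
      I.tree.Anc v y ∧ ¬ Hanging L b v y := (I.isSkeleton L b).near_iff hv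
  by_cases hy : I.tree.Anc v y
  · by_cases hd : I.tree.depth y - I.tree.depth v ≤ I.supDist L b y
    · rw [if_pos ⟨hy, by omega⟩, if_pos (hiff.1 ⟨hy, hd⟩), h, Nat.sub_sub_self (by omega),
        if_pos ⟨by omega, hd⟩, hy.iterate_eq]
    · rw [if_neg (mt hiff.2 (fun h => hd h.2)), h]
      split_ifs with h1 h2
      · exact absurd h2.2 (by omega)
      · rfl
      · rfl
  · rw [if_neg (fun h => hy h.1), if_neg (fun h => hy h.1)]

theorem upcast_outShare {v : I.V} (hv : ¬ I.Skel L b v) :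
    I.tree.upcast (fun v => outShare (3 * (2 * L * b) + 1) (I.info L b v, I.skelSet L b))
      (3 * (2 * L * b) + 1) v = ∑ y, if I.tree.Anc v y ∧ ¬ Hanging L b v y
        then weightTo I.edgeWeight y (fun z => ¬ I.tree.Anc v z) else 0 := by
  refine upcast_share _ (fun v y => weightTo I.edgeWeight y (fun z => ¬ I.tree.Anc v z)) hv
    fun y t => ?_
  by_cases ht : t ≤ 3 * (2 * L * b) + 1 ∧ 3 * (2 * L * b) + 1 - t ≤ I.supDist L b y
  · refine (if_pos ht).trans (Eq.trans ?_ (if_pos ht).symm)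
    exact portSum_eq fun i hi => not_congr (below_iff ht.2 hi)
  · exact (if_neg ht).trans (if_neg ht).symm

theorem upcast_hangShare {v : I.V} (hv : ¬ I.Skel L b v) :
    I.tree.upcast (fun v => hangShare (3 * (2 * L * b) + 1) (I.info L b v, I.skelSet L b))
      (3 * (2 * L * b) + 1) v = ∑ y, if I.tree.Anc v y ∧ ¬ Hanging L b v y
        then weightTo I.edgeWeight y (Hanging L b v) else 0 := by
  refine upcast_share _ (fun v y => weightTo I.edgeWeight y (Hanging L b v)) hv fun y t => ?_
  by_cases ht : t ≤ 3 * (2 * L * b) + 1 ∧ 3 * (2 * L * b) + 1 - t ≤ I.supDist L b y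
  · refine (if_pos ht).trans (Eq.trans ?_ (if_pos ht).symm)
    exact portSum_eq fun i hi => hangs_iff ht.2 hi
  · exact (if_neg ht).trans (if_neg ht).symm

/-- This is `cutWeight_add` for the subtree of `v` and its hanging part, which is empty or the
subtree of a skeleton node. That identity also shows that the subtraction does not truncate. -/
theorem subtreeCut_of_not_skel {v : I.V} (hv : ¬ I.Skel L b v) :
    I.subtreeCut v = (if I.topCode L b v = 0 then 0
        else lookup (I.cutSet L b) (I.topCode L b v - 1)) +
      I.tree.upcast (fun v => outShare (3 * (2 * L * b) + 1) (I.info L b v, I.skelSet L b))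
        (3 * (2 * L * b) + 1) v -
      I.tree.upcast (fun v => hangShare (3 * (2 * L * b) + 1) (I.info L b v, I.skelSet L b))
        (3 * (2 * L * b) + 1) v := by
  have h1 : cutWeight I.edgeWeight (Hanging L b v) = if I.topCode L b v = 0 then 0
      else lookup (I.cutSet L b) (I.topCode L b v - 1) := by
    by_cases hex : ∃ s, I.tree.Top (I.Skel L b) v s
    · obtain ⟨s, hs⟩ := hex
      rw [I.topCode_eq hs, if_neg (by omega), Nat.add_sub_cancel, lookup_cutSet hs.1.1, subtreeCut]
      congr 1
      funext y
      refine propext ⟨?_, fun h => ⟨s, hs, h⟩⟩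
      rintro ⟨s', hs', h⟩
      rwa [hs.unique (I.isSkeleton L b) hs']
    · rw [I.topCode_eq_zero hex, if_pos rfl]
      refine Finset.sum_eq_zero fun y _ => if_neg ?_
      rintro ⟨s, hs, -⟩
      exact hex ⟨s, hs⟩
  have h2 := cutWeight_add I.edgeWeight_comm (X := I.tree.Anc v) (B := Hanging L b v)
    (fun y ⟨s, hs, h⟩ => hs.1.2.trans h)
  rw [h1, ← upcast_outShare hv, ← upcast_hangShare hv] at h2
  rw [subtreeCut]
  omega

end RootedNetwork

/-! ### The complete attempt -/

namespace RootedNetwork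

variable (I : RootedNetwork)

/-- The priority of a node in the search for the minimum. -/
def priority (b : ℕ) (v : I.V) : ℕ :=
  if v = I.T.root then 0 else 2 ^ (4 * b + 1) - (I.subtreeCut v * 2 ^ b + I.N.uid v)

/-- The output of a successful attempt. -/
def answer (b : ℕ) (v : I.V) : OneRespectOutput where
  ownCut := I.subtreeCut v
  minCut := (2 ^ (4 * b + 1) - Finset.univ.sup (I.priority b)) / 2 ^ b
  minNode := (2 ^ (4 * b + 1) - Finset.univ.sup (I.priority b)) % 2 ^ b

/-- What an attempt yields. -/
def result (L b : ℕ) (v : I.V) : Option OneRespectOutput :=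
  if I.Fits L b ∧ I.Small L b (2 * L + 3) then some (I.answer b v) else none

variable {I} {L b : ℕ}

theorem Fits.key_lt (h : I.Fits L b) (v : I.V) :
    I.subtreeCut v * 2 ^ b + I.N.uid v < 2 ^ (4 * b + 1) := by
  have h1 : I.subtreeCut v < 2 ^ (3 * b + 1) := h.cutWeight_lt _
  have h2 := h.uid_lt v
  calc I.subtreeCut v * 2 ^ b + I.N.uid v < (I.subtreeCut v + 1) * 2 ^ b := by
        rw [Nat.succ_mul]
        omega
    _ ≤ 2 ^ (3 * b + 1) * 2 ^ b := Nat.mul_le_mul_right _ h1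
    _ = 2 ^ (4 * b + 1) := by
      rw [← pow_add]
      congr 1
      ring

/-- The largest priority belongs to the least key `cut * 2 ^ b + uid`, whose quotient and remainder
are the two answers. Keys stay below `2 ^ (4 * b + 1)`, so every node other than the root beats the
priority `0` of the root. -/
theorem Fits.answer_spec (h : I.Fits L b) : ∃ s : I.V, s ≠ I.T.root ∧
    (∀ v, v ≠ I.T.root → I.subtreeCut s ≤ I.subtreeCut v) ∧
    ∀ v, I.answer b v = ⟨I.subtreeCut v, I.subtreeCut s, I.N.uid s⟩ := by
  obtain ⟨s, -, hs⟩ := Finset.exists_mem_eq_sup (Finset.univ : Finset I.V)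
    Finset.univ_nonempty (I.priority b)
  have hle : ∀ v, v ≠ I.T.root →
      2 ^ (4 * b + 1) - (I.subtreeCut v * 2 ^ b + I.N.uid v) ≤ I.priority b s := by
    intro v hv
    rw [← hs]
    refine le_trans ?_ (Finset.le_sup (Finset.mem_univ v))
    rw [priority, if_neg hv]
  have hroot : s ≠ I.T.root := by
    intro e
    obtain ⟨v, hv⟩ := exists_ne I.T.root
    have h1 := hle v hv
    rw [priority, if_pos e] at h1
    have := h.key_lt v
    omega
  rw [priority, if_neg hroot] at hle hs
  have hks := h.key_lt s
  refine ⟨s, hroot, fun v hv => ?_, fun v => ?_⟩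
  · by_contra hlt
    push Not at hlt
    have h1 := hle v hv
    have h2 := h.key_lt v
    have h3 := h.uid_lt v
    have h4 : (I.subtreeCut v + 1) * 2 ^ b ≤ I.subtreeCut s * 2 ^ b :=
      Nat.mul_le_mul_right _ hlt
    rw [Nat.succ_mul] at h4
    omega
  · rw [answer, hs, Nat.sub_sub_self hks.le, Nat.mul_comm, Nat.mul_add_mod,
      Nat.mod_eq_of_lt (h.uid_lt s), Nat.mul_add_div (Nat.two_pow_pos b),
      Nat.div_eq_of_lt (h.uid_lt s), Nat.add_zero]

end RootedNetwork

namespace Computes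

variable {L b m K : ℕ}

theorem skelSent (hm : 6 * b + 8 ≤ m) : Computes (Fits L b) ((2 * L + K + 1) * m)
    (fun I => I.info L b) fun I v =>
      (I.info L b v, (_root_.gossip I.N.graph (I.skelItems L b) (2 * L + K + 1) v).2) := by
  refine gossip (P := Fits L b) (C := fun I => I.info L b) (fun c => c.ctx.deg)
    (fun _ _ _ => rfl) (fun I => I.skelItems L b)
    (fun c => if c.mem then {Nat.pair c.ctx.uid c.next} else ∅) (fun _ _ _ => rfl)
    (2 * L + K + 1) fun I hI v x hx => ?_
  unfold skelItems at hx
  split_ifs at hx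
  · rw [Finset.mem_singleton.1 hx]
    have h1 := Nat.pair_lt_two_pow (hI.uid_lt v) (hI.uid_lt (I.sup L b (I.tree.par v)))
    have h2 : 2 ^ (2 * b) < 2 ^ m := Nat.pow_lt_pow_right (by norm_num) (by omega)
    omega
  · simp at hx

theorem card_bound (hm : 6 * b + 8 ≤ m) {I : RootedNetwork} (hI : I.Fits L b) :
    Fintype.card I.V * 2 ^ (2 * b) < 2 ^ m := by
  calc Fintype.card I.V * 2 ^ (2 * b) ≤ 2 ^ b * 2 ^ (2 * b) := Nat.mul_le_mul_right _ hI.card_le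
    _ = 2 ^ (b + 2 * b) := (pow_add _ _ _).symm
    _ < 2 ^ m := Nat.pow_lt_pow_right (by norm_num) (by omega)

/-- The sums are complete only at the root of the search tree, which then broadcasts them as the
sole owner of items. The `i`-th sum is due in round `L + i` with `i < K`, so `L + K` passes are
enough. -/
theorem cutSent (hm : 6 * b + 8 ≤ m) :
    Computes (fun I => I.Fits L b ∧ I.Small L b K)
      ((L + K) * m + (2 * L + K + 1) * m)
      (fun I v => (I.info L b v, I.skelSet L b))
      fun I v => ((I.info L b v, I.skelSet L b), I.cutSet L b) := by
  refine ((upcast (P := fun I => I.Fits L b ∧ I.Small L b K)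
    (C := fun I v => (I.info L b v, I.skelSet L b)) (fun c => c.1.ctx.deg) (fun _ _ _ => rfl)
    (fun I => I.bfs) (fun c => c.1.ctx.bfsChild) (fun _ _ _ _ => Iff.rfl)
    (fun I _ v y => I.bfs_child_adj) (fun I v => skelShare L (I.info L b v, I.skelSet L b))
    (skelShare L) (fun _ _ _ => rfl) (L + K) (fun I hI v t => skelShare_le hI.1 v t)
    (fun I hI => card_bound hm hI.1)).trans
    (gossip (fun c => c.1.1.ctx.deg) (fun _ _ _ => rfl)
      (fun I v => if v = I.T.root then I.cutSet L b else ∅)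
      (fun c => if c.1.1.ctx.hop = 0 then (Finset.range c.1.2.card).image fun i =>
        Nat.pair (coordinate c.1.2 i) (c.2 (L + i)) else ∅) (fun I hI v => ?_)
      (2 * L + K + 1) fun I hI v x hx => ?_)).map (fun c => (c.1.1, c.2)) fun I hI v => ?_
  · change (if v = I.T.root then I.cutSet L b else ∅) = if I.hop v = 0 then _ else _
    refine if_ctx_congr I.hop_eq_zero_iff.symm (fun h0 => ?_) (fun _ => rfl)
    have hv := I.hop_eq_zero_iff.1 h0
    subst hv
    have hsmall : (I.skelSet L b).card ≤ K := hI.2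
    ext x
    simp only [cutSet, Finset.mem_image, Finset.mem_filter, Finset.mem_univ, true_and,
      Finset.mem_range]
    constructor
    · rintro ⟨s, hs, rfl⟩
      obtain ⟨i, hi, he⟩ := exists_of_skel hs
      refine ⟨i, hi, ?_⟩
      rw [if_pos (by omega), he, upcast_skelShare hI.1 hs hi he]
    · rintro ⟨i, hi, rfl⟩
      obtain ⟨s, hs, he⟩ := exists_coordinate hi
      refine ⟨s, hs, ?_⟩
      rw [if_pos (by omega), he, upcast_skelShare hI.1 hs hi he]
  · split_ifs at hx
    · obtain ⟨s, _, rfl⟩ := Finset.mem_image.1 hx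
      have h1 : I.subtreeCut s < 2 ^ (3 * b + 1) := hI.1.cutWeight_lt _
      have h2 : 2 ^ b ≤ 2 ^ (3 * b + 1) := Nat.pow_le_pow_right (by norm_num) (by omega)
      have h3 := Nat.pair_lt_two_pow ((hI.1.uid_lt s).trans_le h2) h1
      have h4 : 2 ^ (2 * (3 * b + 1)) < 2 ^ m := Nat.pow_lt_pow_right (by norm_num) (by omega)
      omega
    · simp at hx
  · refine Prod.ext rfl ?_
    dsimp only
    have h1 : (Finset.univ.biUnion fun v => if v = I.T.root then I.cutSet L b else ∅) =
        I.cutSet L b := by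
      ext x
      simp only [Finset.mem_biUnion, Finset.mem_univ, true_and]
      constructor
      · rintro ⟨a, ha⟩
        split_ifs at ha
        · exact ha
        · simp at ha
      · exact fun hx => ⟨I.T.root, by rwa [if_pos rfl]⟩
    have h2 := (gossip_complete (own := fun v => if v = I.T.root then I.cutSet L b else ∅)
      I.N.connected (K := K) hI.1.dist_le v).2
    rw [h1] at h2
    refine (h2 ?_).symm
    refine le_trans Finset.card_image_le ?_
    rw [← card_skelSet]
    exact hI.2

theorem subtreeCut (hm : 6 * b + 8 ≤ m) :
    Computes (fun I => I.Fits L b ∧ I.Small L b K)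
      ((3 * (2 * L * b) + 1) * m + (3 * (2 * L * b) + 1) * m)
      (fun I v => ((I.info L b v, I.skelSet L b), I.cutSet L b))
      fun I v => (I.context v, I.subtreeCut v) := by
  have h1 := upcast (P := fun I => I.Fits L b ∧ I.Small L b K)
    (C := fun I v => ((I.info L b v, I.skelSet L b), I.cutSet L b)) (fun c => c.1.1.ctx.deg)
    (fun _ _ _ => rfl) (fun I => I.tree) (fun c => c.1.1.ctx.child) (fun _ _ _ _ => Iff.rfl)
    (fun I _ v y => I.child_adj)
    (fun I v => outShare (3 * (2 * L * b) + 1) (I.info L b v, I.skelSet L b))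
    (fun c => outShare (3 * (2 * L * b) + 1) c.1) (fun _ _ _ => rfl) (3 * (2 * L * b) + 1)
    (fun I hI v t => outShare_le hI.1 _ v t) (fun I hI => card_bound hm hI.1)
  have h2 := h1.trans (upcast (fun c => c.1.1.1.ctx.deg)
    (fun _ _ _ => rfl) (fun I => I.tree) (fun c => c.1.1.1.ctx.child) (fun _ _ _ _ => Iff.rfl)
    (fun I _ v y => I.child_adj)
    (fun I v => hangShare (3 * (2 * L * b) + 1) (I.info L b v, I.skelSet L b))
    (fun c => hangShare (3 * (2 * L * b) + 1) c.1.1) (fun _ _ _ => rfl) (3 * (2 * L * b) + 1)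
    (fun I hI v t => hangShare_le hI.1 _ v t) (fun I hI => card_bound hm hI.1))
  refine h2.map (fun c => (c.1.1.1.1.ctx, if c.1.1.1.1.mem then lookup c.1.1.2 c.1.1.1.1.ctx.uid
    else (if c.1.1.1.1.top = 0 then 0 else lookup c.1.1.2 (c.1.1.1.1.top - 1)) +
      c.1.2 (3 * (2 * L * b) + 1) - c.2 (3 * (2 * L * b) + 1))) fun I hI v => ?_
  refine Prod.ext rfl ?_
  simp only [le_refl, if_true]
  change I.subtreeCut v = if I.Skel L b v then lookup (I.cutSet L b) (I.N.uid v) else _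
  by_cases h : I.Skel L b v
  · rw [if_pos h]
    exact (lookup_cutSet h).symm
  · rw [if_neg h]
    exact subtreeCut_of_not_skel h

theorem answer (hm : 6 * b + 8 ≤ m) :
    Computes (fun I => I.Fits L b ∧ I.Small L b (2 * L + 3)) (2 * L * m)
      (fun I v => (I.context v, I.subtreeCut v)) fun I => I.result L b := by
  refine ((flood_max (P := fun I => I.Fits L b ∧ I.Small L b (2 * L + 3))
    (C := fun I v => (I.context v, I.subtreeCut v)) (fun c => c.1.deg) (fun _ _ _ => rfl)
    (fun I v => I.priority b v) (2 * L) (m := m) fun I hI v => ?_).comap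
    (fun c => (c, if c.1.hop = 0 then 0 else 2 ^ (4 * b + 1) - (c.2 * 2 ^ b + c.1.uid)))
    fun I _ v => ?_).map
    (fun c => some ⟨c.1.2, (2 ^ (4 * b + 1) - c.2) / 2 ^ b, (2 ^ (4 * b + 1) - c.2) % 2 ^ b⟩)
    fun I hI v => ?_
  · have h1 : 2 ^ (4 * b + 1) < 2 ^ m := Nat.pow_lt_pow_right (by norm_num) (by omega)
    unfold priority
    split_ifs
    · exact Nat.two_pow_pos m
    · exact (Nat.sub_le _ _).trans_lt h1
  · exact Prod.ext rfl (if_congr I.hop_eq_zero_iff.symm rfl rfl)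
  · rw [result, if_pos hI, RootedNetwork.answer]
    simp only [hI.1.dist_le, if_true]

/-- The number of rounds of an attempt. -/
def attemptTime (L b m : ℕ) : ℕ :=
  (L * m + (2 * L + 1) * m) + ((m + m + m + m) + b * (2 * L * m) +
    (2 * (2 * L * b) + 1) * m + m + (2 * (2 * L * b) + 1) * m + (3 * (2 * L * b) + 3) * m +
    (2 * L + (2 * L + 3) + 1) * m + ((L + (2 * L + 3)) * m + (2 * L + (2 * L + 3) + 1) * m +
    ((3 * (2 * L * b) + 1) * m + (3 * (2 * L * b) + 1) * m) + 2 * L * m))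

/-- There are two global tests, that the parameters fit and that the skeleton is small. All nodes
obtain the same verdict in both, which is what `cases` needs to keep them synchronised. -/
theorem attempt (hm : 6 * b + 8 ≤ m) (hL : L + 1 < 2 ^ m) :
    Computes (fun _ => True) (attemptTime L b m) input fun I => I.result L b := by
  have hm0 : 0 < m := by omega
  refine (fits L b hL).trans (cases (fun s => s.2) (fun _ _ _ _ h => h) ?_ ?_)
  · have h1 := (((((((context (L := L) hm hL).trans (ruling hm0)).trans (hit hm0)).trans
      (skel hm0)).trans (topCode hm)).trans (info hm)).trans (skelSent (K := 2 * L + 3) hm))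
    have h2 := (cutSent (L := L) (K := 2 * L + 3) hm).trans ((subtreeCut hm)) |>.trans (answer hm)
    refine Computes.restrict (P := Fits L b) ?_ fun I hI => hI.2 I.T.root
    -- Smallness is tested on the number of items sent in the gossip; if the test passes, the sent
    -- items are the whole skeleton.
    refine ((h1.trans (cases (fun s => s.2.card ≤ 2 * L + 3) (fun I hI v w h => ?_)
      ((h2.restrict (fun I hI => ⟨hI.1, ?_⟩)).comap id fun I hI v => ?_)
      ((local' (fun _ => none) fun I hI v => ?_).mono (Nat.zero_le _)))).comap
      (fun s => s.1) fun _ _ _ => rfl).mono ?_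
    · exact (gossip_complete I.N.connected hI.dist_le w).1.2
        ((gossip_complete I.N.connected hI.dist_le v).1.1 h)
    · exact (gossip_complete I.N.connected hI.1.dist_le I.T.root).1.1 (hI.2 I.T.root)
    · refine Prod.ext rfl ?_
      have h3 := gossip_complete (own := I.skelItems L b) (K := 2 * L + 3) I.N.connected
        hI.1.dist_le v
      exact (h3.2 (h3.1.1 (hI.2 v))).symm
    · rw [result, if_neg]
      rintro ⟨_, hs⟩
      exact hI.2 v ((gossip_complete I.N.connected hI.1.dist_le v).1.2 hs)
    · exact le_rfl
  · refine (local' (fun _ => none) fun I hI v => ?_).mono (Nat.zero_le _)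
    rw [result, if_neg]
    exact fun h => hI.2 v h.1

end Computes

/-! ### Repeated attempts -/

namespace CongestAlgorithm

variable {Out : Type}

/-- The algorithm that executes the programs `p 0`, `p 1`, … one after the other until one of them
yields an output. -/
def ofAttempts (p : ℕ → LocalInput → NodeProgram (Option Out)) : CongestAlgorithm Out where
  State := LocalInput × ℕ × NodeProgram (Option Out)
  start x := (x, 0, p 0 x)
  send s _ := match s.2.2 with
    | .done _ => []
    | .round b _ => [b]
  step s l := match s.2.2 with
    | .done _ => (s.1, s.2.1 + 1, p (s.2.1 + 1) s.1)
    | .round _ k => (s.1, s.2.1, k fun i => l.getD i [] == [true])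
  output s := match s.2.2 with
    | .done a => a
    | .round _ _ => none

variable {p : ℕ → LocalInput → NodeProgram (Option Out)}

theorem length_message_ofAttempts (s : (ofAttempts p).State) (i : ℕ) :
    ((ofAttempts p).message s i).length ≤ 1 := by
  unfold message
  split_ifs
  · simp
  · obtain ⟨x, j, _ | _⟩ := s <;> simp [ofAttempts]

variable {I : RootedNetwork}

theorem config_ofAttempts_of_runs {q : I.V → NodeProgram (Option Out)} {τ : ℕ}
    {f : I.V → Option Out} (h : I.Runs τ q f) (t j : ℕ)
    (ht : ∀ v, (ofAttempts p).config I.N I.T t v = (I.input v, j, q v)) (v : I.V) :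
    (ofAttempts p).config I.N I.T (t + τ) v = (I.input v, j, .done (f v)) := by
  induction h generalizing t with
  | done f => exact ht v
  | @round τ f b k h ih =>
    rw [Nat.add_left_comm, Nat.add_comm, Nat.add_right_comm, Nat.add_assoc, Nat.add_comm τ,
      ← Nat.add_assoc]
    refine ih (t + 1) fun v => ?_
    have hm : ∀ u i, (ofAttempts p).message ((ofAttempts p).config I.N I.T t u) i = [b u] :=
      fun u i => by
        rw [ht u]
        rfl
    have hk : (fun i => ((ofAttempts p).inbox I.N ((ofAttempts p).config I.N I.T t) v).getD i []
        == [true]) = I.received b v := by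
      funext i
      unfold inbox received nb
      by_cases hi : i < I.N.deg v
      · simp [hi, List.getD, hm]
      · simp [hi, List.getD]
    rw [config, ht v]
    exact congrArg (fun x => (I.input v, j, k v x)) hk

/-- A phase without output costs one more round, in which the next program is loaded. -/
theorem config_ofAttempts {τ : ℕ → ℕ} {f : ℕ → I.V → Option Out}
    (hp : ∀ j, I.Runs (τ j) (fun v => p j (I.input v)) (f j)) {J : ℕ}
    (hf : ∀ j < J, ∀ v, f j v = none) (v : I.V) :
    (ofAttempts p).config I.N I.T (∑ j ∈ Finset.range J, (τ j + 1)) v =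
      (I.input v, J, p J (I.input v)) := by
  induction J generalizing v with
  | zero => rfl
  | succ J ih =>
    have h1 := config_ofAttempts_of_runs (hp J) _ J (ih fun j hj => hf j (by omega)) v
    rw [hf J (by omega)] at h1
    rw [Finset.sum_range_succ, ← Nat.add_assoc, config, h1]
    rfl

theorem output_ofAttempts {τ : ℕ → ℕ} {f : ℕ → I.V → Option Out}
    (hp : ∀ j, I.Runs (τ j) (fun v => p j (I.input v)) (f j)) {J : ℕ}
    (hf : ∀ j < J, ∀ v, f j v = none) (v : I.V) :
    (ofAttempts p).output
      ((ofAttempts p).config I.N I.T (∑ j ∈ Finset.range J, (τ j + 1) + τ J) v) = f J v := by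
  rw [config_ofAttempts_of_runs (hp J) _ J (config_ofAttempts hp hf) v]
  rfl

end CongestAlgorithm

/-! ### The number of rounds -/

namespace RootedNetwork

variable {I : RootedNetwork} {L b : ℕ}

/-- Pairwise distances above `2 * L` allow at most `L + 1` ruling nodes when `n ≤ L * L`, and the
closure has at most `2 * (L + 1) + 1` nodes. -/
theorem Fits.small (h : I.Fits L b) (hn : Fintype.card I.V ≤ L * L) :
    I.Small L b (2 * L + 3) := by
  have h1 := I.tree.card_closure_le (I.Ruling L b)
  have h2 := I.tree.card_mul_le_of_independent (d := L) (Finset.univ.filter (I.Ruling L b))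
    fun u hu v hv huv => ParentMap.cand_independent I.N.uid_injective h.uid_lt
      (Finset.mem_filter.1 hu).2 (Finset.mem_filter.1 hv).2 huv
  have h3 : (Finset.univ.filter (I.Ruling L b)).card - 1 ≤ L := by
    by_contra hc
    have h4 : (L + 1) * (L + 1) ≤ _ := Nat.mul_le_mul_right (L + 1) (Nat.lt_of_not_le hc)
    nlinarith
  rw [Small, card_skelSet]
  have h5 : (Finset.univ.filter (I.Skel L b)).card ≤
    2 * (Finset.univ.filter (I.Ruling L b)).card + 1 := h1
  omega

/-- The reason for `b = j * j`: from `n ≤ 2 ^ (2 * j)` follows `n ^ c ≤ 2 ^ (2 * c * j)`, which is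
below `2 ^ (j * j)` once `j > 2 * c`. The algorithm thus does not depend on `c`. -/
theorem fits_of_le {c : ℕ} (huid : ∀ v, I.N.uid v ≤ Fintype.card I.V ^ c)
    (hw : ∀ e ∈ I.N.graph.edgeSet, I.N.weight e ≤ Fintype.card I.V ^ c) {j : ℕ}
    (hd : I.N.graph.diam ≤ 2 ^ j) (hn : Fintype.card I.V ≤ 2 ^ j * 2 ^ j) (hj : 2 * c < j) :
    I.Fits (2 ^ j) (j * j) := by
  have hc : Fintype.card I.V ^ c < 2 ^ (j * j) := by
    calc Fintype.card I.V ^ c ≤ (2 ^ j * 2 ^ j) ^ c := Nat.pow_le_pow_left hn c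
      _ = 2 ^ (j * (2 * c)) := by rw [← pow_add, ← pow_mul]; congr 1; ring
      _ < 2 ^ (j * j) := Nat.pow_lt_pow_right (by norm_num) (Nat.mul_lt_mul_of_pos_left hj (by omega))
  rintro v (h | h | ⟨y, h⟩)
  · have := SimpleGraph.dist_le_diam (SimpleGraph.connected_iff_ediam_ne_top.1 I.N.connected)
      (u := v) (v := I.T.root)
    exact absurd (h.trans_le this) (by omega)
  · have := huid v
    omega
  · unfold edgeWeight at h
    split_ifs at h with ha
    · have := hw s(v, y) ha
      omega
    · have := Nat.two_pow_pos (j * j)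
      omega

variable (I) in
theorem diam_lt_card : I.N.graph.diam < Fintype.card I.V := by
  obtain ⟨u, v, h⟩ := I.N.graph.exists_dist_eq_diam
  obtain ⟨p, hp, hl⟩ := I.N.connected.exists_path_of_dist u v
  rw [← h, ← hl]
  exact hp.length_lt

end RootedNetwork

theorem Computes.attemptTime_le (j : ℕ) :
    attemptTime (2 ^ j) (j * j) (6 * (j * j) + 8) + 1 ≤ 700 * (j + 1) ^ 4 * 2 ^ j := by
  have h1 : 1 ≤ 2 ^ j := Nat.one_le_two_pow
  have h2 : attemptTime (2 ^ j) (j * j) (6 * (j * j) + 8) + 1 ≤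
      64 * (2 ^ j * (j * j + 1) * (6 * (j * j) + 8)) := by
    generalize 2 ^ j = L at *
    generalize j * j = b
    obtain ⟨L, rfl⟩ := Nat.exists_eq_add_of_le' h1
    unfold attemptTime
    ring_nf
    nlinarith [Nat.zero_le L]
  have h3 : (j * j + 1) * (6 * (j * j) + 8) ≤ 8 * (j + 1) ^ 4 := by
    ring_nf
    nlinarith [Nat.zero_le j]
  calc _ ≤ _ := h2
    _ = 64 * ((j * j + 1) * (6 * (j * j) + 8)) * 2 ^ j := by ring
    _ ≤ 64 * (8 * (j + 1) ^ 4) * 2 ^ j := by gcongr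
    _ ≤ 700 * (j + 1) ^ 4 * 2 ^ j := by
      rw [← mul_assoc]
      gcongr
      norm_num

theorem sum_attemptTime_le {τ : ℕ → ℕ} {J : ℕ}
    (hτ : ∀ j, τ j + 1 ≤ 700 * (j + 1) ^ 4 * 2 ^ j) :
    ∑ j ∈ Finset.range (J + 1), (τ j + 1) ≤ 1400 * (J + 1) ^ 4 * 2 ^ J := by
  calc ∑ j ∈ Finset.range (J + 1), (τ j + 1)
      ≤ ∑ j ∈ Finset.range (J + 1), 700 * (J + 1) ^ 4 * 2 ^ j := by
        refine Finset.sum_le_sum fun j hj => (hτ j).trans ?_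
        have := Finset.mem_range.1 hj
        gcongr
        omega
    _ = 700 * (J + 1) ^ 4 * (2 ^ (J + 1) - 1) := by
        rw [← Finset.mul_sum, Nat.geomSum_eq le_rfl, Nat.div_one]
    _ ≤ 700 * (J + 1) ^ 4 * 2 ^ (J + 1) := Nat.mul_le_mul_left _ (Nat.sub_le _ _)
    _ = 1400 * (J + 1) ^ 4 * 2 ^ J := by ring

/-- An exponent that is large enough for networks with `n` nodes and diameter `d`. -/
def sufficientExponent (c n d : ℕ) : ℕ := Nat.clog 2 (d + n.sqrt + 1) + (2 * c + 1)

theorem le_two_pow_sufficientExponent (c n d : ℕ) :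
    d ≤ 2 ^ sufficientExponent c n d ∧
      n ≤ 2 ^ sufficientExponent c n d * 2 ^ sufficientExponent c n d := by
  have h1 : d + n.sqrt + 1 ≤ 2 ^ sufficientExponent c n d :=
    (Nat.le_pow_clog (by norm_num) _).trans (Nat.pow_le_pow_right (by norm_num)
      (Nat.le_add_right _ _))
  have h2 := Nat.lt_succ_sqrt n
  exact ⟨by omega, h2.le.trans (Nat.mul_le_mul (by omega) (by omega))⟩

theorem two_pow_sufficientExponent_le {c n d : ℕ} (hn : 1 ≤ n) :
    2 ^ sufficientExponent c n d ≤ 2 ^ (2 * c + 3) * (d + n.sqrt) := by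
  have hs : 1 ≤ n.sqrt := Nat.sqrt_pos.2 hn
  have h1 := Nat.pow_pred_clog_lt_self (b := 2) (by norm_num) (x := d + n.sqrt + 1) (by omega)
  have h2 := Nat.clog_pos (b := 2) (by norm_num) (n := d + n.sqrt + 1) (by omega)
  obtain ⟨e, he⟩ := Nat.exists_eq_succ_of_ne_zero h2.ne'
  rw [he, Nat.pred_succ] at h1
  rw [sufficientExponent, he]
  calc 2 ^ (e + 1 + (2 * c + 1)) = 2 ^ (2 * c + 2) * 2 ^ e := by rw [← pow_add]; congr 1; omega
    _ ≤ 2 ^ (2 * c + 2) * (2 * (d + n.sqrt)) := by gcongr; omega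
    _ = 2 ^ (2 * c + 3) * (d + n.sqrt) := by ring

/-- As `d < n`, the exponent is `O(log n)`, while its power of two is `O(√n + d)`. -/
theorem time_bound (c n d : ℕ) (hn : 2 ≤ n) (hd : d < n) :
    ((1400 * (sufficientExponent c n d + 1) ^ 4 * 2 ^ sufficientExponent c n d : ℕ) : ℝ) ≤
      1400 * (2 * c + 6) ^ 4 * 2 ^ (2 * c + 3) * (Real.sqrt n + d) * Real.logb 2 n ^ 4 := by
  set J := sufficientExponent c n d
  have h1 : 2 ^ J ≤ 2 ^ (2 * c + 3) * (d + n.sqrt) :=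
    two_pow_sufficientExponent_le (by omega)
  have hlog : 1 ≤ Real.logb 2 n := by
    rw [Real.le_logb_iff_rpow_le (by norm_num) (by positivity), Real.rpow_one]
    exact_mod_cast hn
  have h2 : 2 ^ J ≤ 2 ^ (2 * c + 4) * n := by
    calc 2 ^ J ≤ 2 ^ (2 * c + 3) * (d + n.sqrt) := h1
      _ ≤ 2 ^ (2 * c + 3) * (n + n) := by
        gcongr
        exact Nat.sqrt_le_self n
      _ = 2 ^ (2 * c + 4) * n := by ring
  have h3 : (J : ℝ) ≤ 2 * c + 4 + Real.logb 2 n := by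
    have h4 : ((2 : ℝ) ^ J) ≤ 2 ^ (2 * c + 4) * n := by exact_mod_cast h2
    have h5 := Real.logb_le_logb_of_le (b := 2) (by norm_num) (by positivity) h4
    rw [Real.logb_mul (by positivity) (by positivity), Real.logb_pow, Real.logb_pow,
      Real.logb_self_eq_one (by norm_num)] at h5
    push_cast at h5
    linarith
  have h4 : (J : ℝ) + 1 ≤ (2 * c + 6) * Real.logb 2 n := by nlinarith
  have h5 : ((2 : ℝ) ^ J) ≤ 2 ^ (2 * c + 3) * (Real.sqrt n + d) := by
    have h6 : ((2 : ℝ) ^ J) ≤ 2 ^ (2 * c + 3) * (d + n.sqrt) := by exact_mod_cast h1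
    refine h6.trans ?_
    have := Real.nat_sqrt_le_real_sqrt (a := n)
    rw [add_comm (d : ℝ)]
    gcongr
  push_cast
  calc 1400 * ((J : ℝ) + 1) ^ 4 * 2 ^ J
      ≤ 1400 * ((2 * c + 6) * Real.logb 2 n) ^ 4 * (2 ^ (2 * c + 3) * (Real.sqrt n + d)) := by
        gcongr
    _ = _ := by ring

/-- One-bit programs for the attempts with doubling parameters. -/
theorem exists_attempts : ∃ p : ℕ → LocalInput → NodeProgram (Option OneRespectOutput),
    ∀ (j : ℕ) (I : RootedNetwork), ∃ τ, τ + 1 ≤ 700 * (j + 1) ^ 4 * 2 ^ j ∧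
      I.Runs τ (fun v => p j (I.input v)) (I.result (2 ^ j) (j * j)) := by
  have h : ∀ j : ℕ, 2 ^ j + 1 < 2 ^ (6 * (j * j) + 8) := fun j => by
    calc 2 ^ j + 1 < 2 ^ j * 2 ^ 2 := by
          have := Nat.two_pow_pos j
          omega
      _ = 2 ^ (j + 2) := (pow_add _ _ _).symm
      _ ≤ 2 ^ (6 * (j * j) + 8) := Nat.pow_le_pow_right (by norm_num) (by nlinarith)
  choose p hp using fun j => Computes.attempt (b := j * j) le_rfl (h j)
  refine ⟨p, fun j I => ?_⟩
  obtain ⟨τ, hτ, hr⟩ := hp j I trivial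
  exact ⟨τ, (Nat.add_le_add_right hτ 1).trans (Computes.attemptTime_le j), hr⟩

end

/-! ### The main theorem. -/

theorem mainTheorem1 :
    ∃ (A : CongestAlgorithm OneRespectOutput) (k : ℕ), ∀ c : ℕ, ∃ B C : ℝ,
      ∀ (V : Type) [Fintype V] [Nontrivial V] (N : Network V)
        (T : RootedSpanningTree N.graph),
        (∀ v : V, N.uid v ≤ Fintype.card V ^ c) →
        (∀ e ∈ N.graph.edgeSet, N.weight e ≤ Fintype.card V ^ c) →
        -- every message ever sent has `O(log n)` bits
        (∀ (t : ℕ) (v : V) (i : Fin (N.deg v)),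
          ((A.message (A.config N T t v) i).length : ℝ) ≤ B * Real.logb 2 (Fintype.card V)) ∧
        -- after `R = Õ(√n + D)` rounds all nodes have halted with the correct output
        ∃ R : ℕ,
          (R : ℝ) ≤ C * (Real.sqrt (Fintype.card V) + N.graph.diam) *
            Real.logb 2 (Fintype.card V) ^ k ∧
          ∃ (cStar : ℕ) (vStar : V),
            IsLeast {x : ℕ | ∃ v : V, v ≠ T.root ∧ x = N.cut (T.desc v)} cStar ∧
            vStar ≠ T.root ∧ N.cut (T.desc vStar) = cStar ∧
            ∀ v : V, A.output (A.config N T R v) =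
              some { ownCut := N.cut (T.desc v), minCut := cStar, minNode := N.uid vStar } := by
  obtain ⟨p, hp⟩ := exists_attempts
  refine ⟨.ofAttempts p, 4, fun c => ⟨1, 1400 * (2 * c + 6) ^ 4 * 2 ^ (2 * c + 3), ?_⟩⟩
  intro V _ _ N T huid hw
  have hcard : 2 ≤ Fintype.card V := Fintype.one_lt_card
  constructor
  · intro t v i
    have hlog : 1 ≤ Real.logb 2 (Fintype.card V) := by
      rw [Real.le_logb_iff_rpow_le (by norm_num) (by positivity), Real.rpow_one]
      exact_mod_cast hcard
    rw [one_mul]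
    refine le_trans ?_ hlog
    exact_mod_cast CongestAlgorithm.length_message_ofAttempts _ _
  · let I : RootedNetwork := ⟨V, N, T⟩
    choose τ hτ hr using fun j => hp j I
    let succeeds : ℕ → Prop := fun j => I.Fits (2 ^ j) (j * j) ∧
      I.Small (2 ^ j) (j * j) (2 * 2 ^ j + 3)
    set j₀ := sufficientExponent c (Fintype.card V) N.graph.diam with hj₀
    have hs : succeeds j₀ := by
      obtain ⟨h1, h2⟩ := le_two_pow_sufficientExponent c (Fintype.card V) N.graph.diam
      have h3 : I.Fits (2 ^ j₀) (j₀ * j₀) := RootedNetwork.fits_of_le huid hw h1 h2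
        (by rw [hj₀, sufficientExponent]; omega)
      exact ⟨h3, h3.small h2⟩
    classical
    -- Success may come before `j₀`. This is harmless, since correctness of the answer rests on the
    -- tests passed and not on the size of `j`.
    have hex : ∃ j, succeeds j := ⟨j₀, hs⟩
    have hJ := Nat.find_spec hex
    have hJ₀ : Nat.find hex ≤ j₀ := Nat.find_min' hex hs
    have hfail : ∀ j < Nat.find hex, ∀ v, I.result (2 ^ j) (j * j) v = none :=
      fun j hj v => if_neg (Nat.find_min hex hj)
    set J := Nat.find hex
    refine ⟨∑ j ∈ Finset.range J, (τ j + 1) + τ J, ?_, ?_⟩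
    · refine le_trans ?_ (time_bound c (Fintype.card V) N.graph.diam hcard I.diam_lt_card)
      rw [Nat.cast_le]
      refine le_trans ?_ (sum_attemptTime_le hτ)
      calc ∑ j ∈ Finset.range J, (τ j + 1) + τ J ≤ ∑ j ∈ Finset.range (J + 1), (τ j + 1) := by
            rw [Finset.sum_range_succ]
            omega
        _ ≤ _ := Finset.sum_le_sum_of_subset (Finset.range_subset_range.2 (by omega))
    · obtain ⟨s, hs0, hmin, hans⟩ := hJ.1.answer_spec
      simp only [RootedNetwork.subtreeCut_eq] at hmin hans
      refine ⟨N.cut (T.desc s), s, ⟨⟨s, hs0, rfl⟩, ?_⟩, hs0, rfl, fun v => ?_⟩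
      · rintro _ ⟨v, hv, rfl⟩
        exact hmin v hv
      · refine (CongestAlgorithm.output_ofAttempts hr hfail v).trans ?_
        rw [RootedNetwork.result, if_pos hJ, hans]
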